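/- For an integer $n\ge 1$ and $0<\rho\le 1$, say that a graph on $n$ vertices has the property $\rho$-IndepSet if it has an independent set of at least $\rho n$ vertices. A graph $G$ on $n$ vertices is $\epsilon$-close to $\rho$-IndepSet if it can be given the property by adding or removing at most $\epsilon n^2$ edges, and $\epsilon$-far from it if at least $\epsilon n^2$ edges must be added or removed to give it the property. For constants $\delta_1>\delta_2$, an $(\epsilon_1,\epsilon_2)$-tolerant tester with sample size $s\le n$ draws a uniformly random set $S$ of $s$ vertices (without replacement), inspects only $G[S]$, and (possibly using further randomness) accepts with probability at least $\delta_1$ if $G$ is $\epsilon_1$-close to $\rho$-IndepSet, and with probability at most $\delta_2$ if $G$ is $\epsilon_2$-far from it. The sample complexity of $(\epsilon_1,\epsilon_2)$-tolerant testing is the least $s$ for which such a tester exists. Write $\log=\log_2$. Theorem. There are absolute constants $c,C_1,C_2>0$ and $0<\delta_2<\delta_1<1$ such that for all $\epsilon>0$, all $\rho\in(0,1]$ and all $n\ge 1$, with $\epsilon_1=\frac{\epsilon}{c\log^4(1/\epsilon)}$ (for $\epsilon=1$, where no graph is $\epsilon$-far, $\epsilon_1$ is read as $0$): (a) The sample complexity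 of $(\epsilon_1,\epsilon)$-tolerant testing of $\rho$-IndepSet on $n$-vertex graphs is at most $C_1\,\frac{\rho^3}{\epsilon^2}\,\log^5\!\left(2+\frac{\rho^3}{\epsilon^2}\right)$; that is, it is $\widetilde O(\rho^3/\epsilon^2)$, uniformly in $n$. (b) Let $s=\max\left(0,\left\lceil C_2\,\rho^3\log^5(1/\epsilon)/\epsilon^2\right\rceil\right)$. If $n\ge s$, then the following is an $(\epsilon_1,\epsilon)$-tolerant tester for $\rho$-IndepSet with sample size $s$ (and thresholds $\delta_1,\delta_2$): accept if and only if the sample $S$ contains a set of exactly $\lfloor\rho s\rfloor$ vertices that spans at most $2\epsilon_1 s^2$ edges. -/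

import Mathlib

noncomputable section

namespace DenseTesting

/-- The number of edges that have to be added or removed to turn `G` into `H`. -/
def editDist {n : ℕ} (G H : SimpleGraph (Fin n)) : ℕ :=
  (symmDiff G.edgeSet H.edgeSet).ncard

/-- `G` is `ε`-close to the property `P`: it can be given the property `P` by adding or removing
at most `ε n²` edges. -/
def IsClose {n : ℕ} (P : Set (SimpleGraph (Fin n))) (ε : ℝ) (G : SimpleGraph (Fin n)) : Prop :=
  ∃ H ∈ P, (editDist G H : ℝ) ≤ ε * (n : ℝ) ^ 2

/-- `G` is `ε`-far from the property `P`: at least `ε n²` edges must be added or removed to give it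
the property `P`. -/
def IsFar {n : ℕ} (P : Set (SimpleGraph (Fin n))) (ε : ℝ) (G : SimpleGraph (Fin n)) : Prop :=
  ∀ H ∈ P, ε * (n : ℝ) ^ 2 ≤ (editDist G H : ℝ)

/-- The `ρ`-independent-set property of `n`-vertex graphs: some independent set has at least
`ρ n` vertices (equivalently, exactly `⌈ρ n⌉` vertices). -/
def IndepSetProperty (n : ℕ) (ρ : ℝ) : Set (SimpleGraph (Fin n)) :=
  {G | ∃ I : Finset (Fin n), G.IsIndepSet (I : Set (Fin n)) ∧ ρ * (n : ℝ) ≤ (I.card : ℝ)}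

/-- A (randomized) decision rule that sees a sample `S` of the vertices and the induced subgraph
`G[S]`, and nothing else of `G`. Its value is the probability (over its internal
randomness) with which it accepts. -/
abbrev DecisionRule (n : ℕ) : Type :=
  (S : Finset (Fin n)) → SimpleGraph (S : Set (Fin n)) → unitInterval

/-- The probability that the rule `A` accepts `G` when `S` is a uniformly random set of `s`
vertices, sampled without replacement (meaningful for `s ≤ n`). -/
def acceptProb {n : ℕ} (s : ℕ) (A : DecisionRule n) (G : SimpleGraph (Fin n)) : ℝ :=
  (∑ S ∈ (Finset.univ : Finset (Fin n)).powersetCard s,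
    (A S (G.induce (S : Set (Fin n))) : ℝ)) / (n.choose s : ℝ)

/-- The rule `A`, run on a uniformly random sample of `s` vertices, is an `(ε₁, ε₂)`-tolerant
tester for `P` on `n`-vertex graphs with acceptance thresholds `δ₁` (for close graphs) and `δ₂`
(for far graphs). -/
def IsTolerantTester {n : ℕ} (δ₁ δ₂ ε₁ ε₂ : ℝ) (P : Set (SimpleGraph (Fin n)))
    (s : ℕ) (A : DecisionRule n) : Prop :=
  s ≤ n ∧
  (∀ G : SimpleGraph (Fin n), IsClose P ε₁ G → δ₁ ≤ acceptProb s A G) ∧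
  (∀ G : SimpleGraph (Fin n), IsFar P ε₂ G → acceptProb s A G ≤ δ₂)

/-- The sample complexity of `(ε₁, ε₂)`-tolerant testing of `P` on `n`-vertex graphs: the least
`s` for which a tester with `s` samples exists (`⊤` if there is none). -/
def sampleComplexity {n : ℕ} (δ₁ δ₂ ε₁ ε₂ : ℝ) (P : Set (SimpleGraph (Fin n))) : ℕ∞ :=
  ⨅ s ∈ {s : ℕ | ∃ A : DecisionRule n, IsTolerantTester δ₁ δ₂ ε₁ ε₂ P s A}, (s : ℕ∞)

open Classical in
/-- The rule that accepts iff the sample contains a set `J` of exactly `k` vertices that spans at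
most `m` edges. -/
def sparseSubsetRule (n k : ℕ) (m : ℝ) : DecisionRule n := fun S H =>
  if ∃ J : Finset (S : Set (Fin n)), J.card = k ∧
      ((H.induce (J : Set (S : Set (Fin n)))).edgeSet.ncard : ℝ) ≤ m
  then 1 else 0

end DenseTesting

end

/-! ### Uniformly random subsets and adjacency counts -/

namespace DenseTesting

open Finset

/-! Completeness. Let `I` have at least `ρ n` vertices and span at most `ε₁ n²` edges. The size of
`S ∩ I` is hypergeometric with mean at least `⌊ρ s⌋`, so it reaches `⌊ρ s⌋` with probability at
least `1/4` (`quarter_le_card_filter_le_inter`, via log-concavity). Given its size, the trace is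
uniform in `I`, so by Markov it spans at most twice the average with probability at least `1/2`.
Averaging then cuts it down to exactly `⌊ρ s⌋` vertices. This gives `1/8`.

Soundness uses graph containers. A short word of vertices determines a container: each letter either
removes the neighbours of a vertex, or removes all vertices of larger degree in the current
container. Call a pair of words over `S` bad if the intersection of their containers has density `ρ
- δ`, with `δ` at least a minimal gap and at least proportional to the number of letters, and yet
contains at least `(ρ - δ/2) s` vertices of `S`. By Chernoff and a union bound, a bad pair exists
with probability at most `1/16` (`card_filter_hasDenseContainer_le`). A letter costs a factor `O(s)`
in the union bound, not `n`, because its vertex must itself be sampled; hence the bound is uniform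
in `n`.

What remains is deterministic (`false_of_sparseSetting`): without bad pairs, a far graph has no
sparse `J ⊆ S` with about `ρ s` vertices. For each scale `κ_i = ρ/2^i`, letters are appended as long
as they shrink the container much more than they cost in `J`. A logarithmic potential bounds the
total cost by `κ_i/10`. When no cheap letter is left, the degrees in the container are controlled
level by level. If the container exceeds density `ρ` by at most `κ_i`, its low-degree part is
sparse. If it is larger, intersecting with the sparse container of the previous scale gives a sparse
set of density at least `ρ - 8κ_i`; a random piece of the large container completes it to density
`ρ` with too few edges for a far graph. At the last scale `κ_I ≤ ε/(8ρ)`, and the sparse container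
can be completed to `ρ n` vertices arbitrarily, which is again a contradiction.

Throughout, `adjPairs` counts ordered pairs, hence twice the edges. -/

lemma choose_sub_le_pow_mul {b w t : ℕ} (htw : t ≤ w) (hwb : w ≤ b) :
    ((b - t).choose (w - t) : ℝ) ≤ ((w : ℝ) / b) ^ t * b.choose w := by
  induction t with
  | zero => simp
  | succ t ih =>
    have ih := ih (by omega)
    obtain ⟨x, hx⟩ : ∃ x, b - t = x + 1 := ⟨b - t - 1, by omega⟩
    obtain ⟨y, hy⟩ : ∃ y, w - t = y + 1 := ⟨w - t - 1, by omega⟩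
    have e1 : b - (t + 1) = x := by omega
    have e2 : w - (t + 1) = y := by omega
    rw [e1, e2]
    rw [hx, hy] at ih
    have key : ((x : ℝ) + 1) * (x.choose y) = ((x + 1).choose (y + 1)) * ((y : ℝ) + 1) := by
      exact_mod_cast Nat.add_one_mul_choose_eq x y
    have hb : (b : ℝ) = x + 1 + t := by
      have : b = x + 1 + t := by omega
      exact_mod_cast this
    have hw : (w : ℝ) = y + 1 + t := by
      have : w = y + 1 + t := by omega
      exact_mod_cast this
    have hyx : (y : ℝ) ≤ x := by
      have : y ≤ x := by omega
      exact_mod_cast this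
    have hb0 : (0 : ℝ) < b := by rw [hb]; positivity
    -- The quotient of the two binomials is a product of factors `(w - i) / (b - i)`, each at most
    -- `w / b`.
    have hr : ((y : ℝ) + 1) / (x + 1) ≤ (w : ℝ) / b := by
      rw [div_le_div_iff₀ (by positivity) hb0, hb, hw]
      nlinarith [mul_nonneg (sub_nonneg.2 hyx) (Nat.cast_nonneg (α := ℝ) t)]
    have : (x.choose y : ℝ) = ((y : ℝ) + 1) / (x + 1) * ((x + 1).choose (y + 1)) := by
      field_simp
      linarith
    rw [this, pow_succ, mul_right_comm, mul_comm]
    exact mul_le_mul ih hr (by positivity) (by positivity)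

section

variable {V : Type*} [DecidableEq V]

/-- A uniformly random `w`-subset of `B` contains a given set `T` with probability at most
`(w / |B|) ^ |T|`. -/
lemma card_filter_subset_le {B T : Finset V} {w : ℕ} (hw : w ≤ #B) :
    (#{S ∈ B.powersetCard w | T ⊆ S} : ℝ) ≤ ((w : ℝ) / #B) ^ #T * (#B).choose w := by
  by_cases h : T ⊆ B ∧ #T ≤ w
  · rw [Finset.card_filter_powersetCard_subset _ _ _ h.1 h.2]
    exact choose_sub_le_pow_mul h.2 hw
  · have : ({S ∈ B.powersetCard w | T ⊆ S} : Finset (Finset V)) = ∅ := by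
      rw [Finset.filter_eq_empty_iff]
      intro S hS hTS
      rw [mem_powersetCard] at hS
      exact h ⟨hTS.trans hS.1, hS.2 ▸ card_le_card hTS⟩
    rw [this]
    simp only [card_empty, Nat.cast_zero]
    positivity

end

section adjacencies

variable {V : Type*}

open Classical in
/-- The number of neighbours of `v` in `C`. -/
noncomputable def degInto (G : SimpleGraph V) (C : Finset V) (v : V) : ℕ := #{u ∈ C | G.Adj v u}

/-- The number of pairs `(a, b) ∈ A × B` with `a` adjacent to `b`. -/
noncomputable def adjPairs (G : SimpleGraph V) (A B : Finset V) : ℕ := ∑ a ∈ A, degInto G B a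

variable {G : SimpleGraph V}

lemma degInto_mono {B C : Finset V} (h : B ⊆ C) (v : V) : degInto G B v ≤ degInto G C v := by
  classical
  exact card_le_card (filter_subset_filter _ h)

lemma degInto_le_card (C : Finset V) (v : V) : degInto G C v ≤ #C := by
  classical exact card_filter_le _ _

lemma adjPairs_mono {A A' B B' : Finset V} (hA : A ⊆ A') (hB : B ⊆ B') :
    adjPairs G A B ≤ adjPairs G A' B' :=
  (sum_le_sum fun _ _ => degInto_mono hB _).trans (sum_le_sum_of_subset hA)

open Classical in
lemma adjPairs_eq_sum (A B : Finset V) :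
    adjPairs G A B = ∑ a ∈ A, ∑ b ∈ B, if G.Adj a b then 1 else 0 := by
  simp only [adjPairs, degInto, card_filter]

lemma adjPairs_comm (A B : Finset V) : adjPairs G A B = adjPairs G B A := by
  classical
  rw [adjPairs_eq_sum, adjPairs_eq_sum, sum_comm]
  simp only [G.adj_comm]

lemma adjPairs_le_mul (A B : Finset V) : adjPairs G A B ≤ #A * #B := by
  rw [adjPairs, ← smul_eq_mul]
  exact sum_le_card_nsmul _ _ _ fun a _ => degInto_le_card _ _

variable [DecidableEq V]

lemma degInto_union {A B : Finset V} (h : Disjoint A B) (v : V) :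
    degInto G (A ∪ B) v = degInto G A v + degInto G B v := by
  classical
  rw [degInto, filter_union, card_union_of_disjoint (disjoint_filter_filter h)]
  rfl

lemma adjPairs_union_self {A B : Finset V} (h : Disjoint A B) :
    adjPairs G (A ∪ B) (A ∪ B) = adjPairs G A A + 2 * adjPairs G B A + adjPairs G B B := by
  rw [adjPairs, sum_union h]
  simp only [degInto_union h, sum_add_distrib]
  have := adjPairs_comm (G := G) A B
  simp only [adjPairs] at *
  omega

lemma sum_powersetCard_adjPairs_left_le {B : Finset V} (D : Finset V) {w : ℕ} (hw : w ≤ #B) :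
    (∑ W ∈ B.powersetCard w, (adjPairs G W D : ℝ)) ≤
      (w : ℝ) / #B * adjPairs G B D * (#B).choose w := by
  have h1 : (∑ W ∈ B.powersetCard w, (adjPairs G W D : ℝ)) =
      ∑ u ∈ B, (degInto G D u : ℝ) * #{W ∈ B.powersetCard w | {u} ⊆ W} := by
    have : ∀ W ∈ B.powersetCard w, (adjPairs G W D : ℝ) =
        ∑ u ∈ B, if {u} ⊆ W then (degInto G D u : ℝ) else 0 := by
      intro W hW
      rw [mem_powersetCard] at hW
      simp only [singleton_subset_iff]
      rw [adjPairs, ← sum_filter, filter_mem_eq_inter, inter_eq_right.2 hW.1]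
      push_cast; rfl
    rw [sum_congr rfl this, sum_comm]
    refine sum_congr rfl fun u _ => ?_
    rw [← sum_filter, sum_const, nsmul_eq_mul, mul_comm]
  rw [h1, adjPairs]
  push_cast
  rw [mul_sum, sum_mul]
  refine sum_le_sum fun u _ => ?_
  have := card_filter_subset_le (T := {u}) hw
  rw [card_singleton, pow_one] at this
  calc _ ≤ (degInto G D u : ℝ) * ((w : ℝ) / #B * (#B).choose w) := by gcongr
    _ = _ := by ring

lemma sum_powersetCard_adjPairs_self_le {B : Finset V} {w : ℕ} (hw : w ≤ #B) :
    (∑ W ∈ B.powersetCard w, (adjPairs G W W : ℝ)) ≤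
      ((w : ℝ) / #B) ^ 2 * adjPairs G B B * (#B).choose w := by
  classical
  have h1 : (∑ W ∈ B.powersetCard w, (adjPairs G W W : ℝ)) =
      ∑ u ∈ B, ∑ v ∈ B, (if G.Adj u v then (1 : ℝ) else 0) *
        #{W ∈ B.powersetCard w | {u, v} ⊆ W} := by
    have : ∀ W ∈ B.powersetCard w, (adjPairs G W W : ℝ) =
        ∑ u ∈ B, ∑ v ∈ B, if {u, v} ⊆ W then (if G.Adj u v then (1 : ℝ) else 0) else 0 := by
      intro W hW
      rw [mem_powersetCard] at hW
      rw [adjPairs_eq_sum]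
      push_cast
      rw [← sum_subset hW.1]
      · refine sum_congr rfl fun u hu => ?_
        rw [← sum_subset hW.1]
        · refine sum_congr rfl fun v hv => ?_
          rw [if_pos (show {u, v} ⊆ W by simp [insert_subset_iff, hu, hv])]
        · intro v _ hv
          rw [if_neg]
          simp [insert_subset_iff, hv]
      · intro u _ hu
        refine sum_eq_zero fun v _ => ?_
        rw [if_neg]
        simp [insert_subset_iff, hu]
    rw [sum_congr rfl this, sum_comm]
    refine sum_congr rfl fun u _ => ?_
    rw [sum_comm]
    refine sum_congr rfl fun v _ => ?_
    rw [← sum_filter, sum_const, nsmul_eq_mul, mul_comm]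
  rw [h1, adjPairs_eq_sum]
  push_cast
  rw [mul_sum, sum_mul]
  refine sum_le_sum fun u _ => ?_
  rw [mul_sum, sum_mul]
  refine sum_le_sum fun v _ => ?_
  split_ifs with huv
  · have := card_filter_subset_le (T := {u, v}) hw
    rw [card_pair huv.ne] at this
    linarith
  · simp

/-- Some `w`-subset of `B` has at most the average number of adjacencies, within itself and to
a fixed set `D`. -/
lemma exists_subset_adjPairs_le {B : Finset V} (D : Finset V) {w : ℕ} (hw : w ≤ #B) :
    ∃ W ⊆ B, #W = w ∧ 2 * (adjPairs G W D : ℝ) + adjPairs G W W ≤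
      2 * ((w : ℝ) / #B * adjPairs G B D) + ((w : ℝ) / #B) ^ 2 * adjPairs G B B := by
  have hne : (B.powersetCard w).Nonempty := powersetCard_nonempty.2 hw
  obtain ⟨W, hW, h⟩ := exists_le_of_sum_le (s := B.powersetCard w)
    (f := fun W => 2 * (adjPairs G W D : ℝ) + adjPairs G W W)
    (g := fun _ => 2 * ((w : ℝ) / #B * adjPairs G B D) + ((w : ℝ) / #B) ^ 2 * adjPairs G B B)
    hne (by
      rw [sum_add_distrib, ← mul_sum, sum_const, card_powersetCard, nsmul_eq_mul]
      have h1 := sum_powersetCard_adjPairs_left_le (G := G) D hw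
      have h2 := sum_powersetCard_adjPairs_self_le (G := G) hw
      linarith)
  rw [mem_powersetCard] at hW
  exact ⟨W, hW.1, hW.2, h⟩

end adjacencies

/-! ### Logarithmic potential and degree thresholds -/

/-- A concave potential with `ψ' = 1 / max 1 z`. -/
noncomputable def logPotential (z : ℝ) : ℝ := if z ≤ 1 then z - 1 else Real.log z

/-- By concavity, the slope at the right endpoint `z` is the smallest on the interval. It turns a
multiplicative gain-to-cost requirement into a telescoping bound on the total cost. -/
lemma sub_div_max_le_logPotential_sub {z z' : ℝ} (h : z' ≤ z) :
    (z - z') / max 1 z ≤ logPotential z - logPotential z' := by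
  unfold logPotential
  rcases le_or_gt z 1 with hz | hz
  · rw [max_eq_left hz, if_pos hz, if_pos (h.trans hz)]
    linarith
  · rw [max_eq_right hz.le, if_neg hz.not_ge]
    have hz0 : 0 < z := by linarith
    split_ifs with hz'
    · have h1 := Real.one_sub_inv_le_log_of_pos hz0
      have h2 : (z - z') / z = 1 - z' * z⁻¹ := by field_simp
      have h3 : z⁻¹ ≤ 1 := inv_le_one_of_one_le₀ hz.le
      rw [h2]
      nlinarith [mul_nonneg (sub_nonneg.2 hz') (sub_nonneg.2 h3)]
    · push Not at hz'
      have hz'0 : 0 < z' := by linarith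
      have h1 := Real.one_sub_inv_le_log_of_pos (div_pos hz0 hz'0)
      rw [Real.log_div hz0.ne' hz'0.ne'] at h1
      have h2 : (z - z') / z = 1 - (z / z')⁻¹ := by field_simp
      rw [h2]
      exact h1

lemma logPotential_le_log {z w : ℝ} (h : z ≤ w) (hw : 1 ≤ w) :
    logPotential z ≤ Real.log w := by
  unfold logPotential
  split_ifs with hz
  · linarith [Real.log_nonneg hw]
  · exact Real.log_le_log (by linarith) h

lemma neg_logPotential_le (z : ℝ) : -logPotential z ≤ 1 + max 0 (-z) := by
  unfold logPotential
  split_ifs with hz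
  · linarith [le_max_right 0 (-z)]
  · linarith [le_max_left 0 (-z), Real.log_nonneg (not_le.1 hz).le]

/-- A level `D` at which the number of elements with value at least `D` crosses `q`. -/
lemma exists_threshold {V : Type*} (T : Finset V) (f : V → ℕ) {q : ℝ} (hq : 0 < q)
    (hqT : q ≤ #T) : ∃ D : ℕ, q ≤ #{v ∈ T | D ≤ f v} ∧ (#{v ∈ T | D < f v} : ℝ) < q := by
  classical
  have hex : ∃ D : ℕ, (#{v ∈ T | D < f v} : ℝ) < q := by
    refine ⟨T.sup f, ?_⟩
    rw [filter_eq_empty_iff.2 fun v hv => not_lt.2 (le_sup hv)]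
    simpa using hq
  refine ⟨Nat.find hex, ?_, Nat.find_spec hex⟩
  rcases Nat.eq_zero_or_pos (Nat.find hex) with h0 | h0
  · rw [h0]
    simpa using hqT
  · have := Nat.find_min hex (Nat.sub_lt h0 one_pos)
    rw [not_lt] at this
    refine this.trans (le_of_eq ?_)
    congr 2
    ext v
    simp only [mem_filter]
    constructor <;> rintro ⟨h1, h2⟩ <;> refine ⟨h1, ?_⟩ <;> omega

/-- The first `k` with `d ≤ D k` contributes a term that already suffices, so `D` need not be
monotone. -/
lemma le_sum_of_thresholds (D : ℕ → ℕ) (m d : ℕ) (h : d ≤ D m) :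
    d ≤ ∑ k ∈ range (m + 1), if k = 0 ∨ D (k - 1) < d then D k else 0 := by
  classical
  have hex : ∃ k, d ≤ D k := ⟨m, h⟩
  have hk := Nat.find_spec hex
  have hkm := Nat.find_min' hex h
  set k := Nat.find hex with hkdef
  have hcond : k = 0 ∨ D (k - 1) < d := by
    rcases Nat.eq_zero_or_pos k with h0 | h0
    · exact Or.inl h0
    · exact Or.inr (not_le.1 (Nat.find_min hex (Nat.sub_lt h0 one_pos)))
  calc d ≤ if k = 0 ∨ D (k - 1) < d then D k else 0 := by rw [if_pos hcond]; exact hk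
    _ ≤ _ := single_le_sum (f := fun k => if k = 0 ∨ D (k - 1) < d then D k else 0)
        (fun _ _ => Nat.zero_le _) (mem_range.2 (by omega))

/-! ### Containers of words and the sparse setting -/

section containers

variable {V : Type*}

open Classical in
/-- One step of the container algorithm: `(v, true)` removes the neighbours of `v`, and
`(v, false)` removes the vertices whose degree in the current container exceeds that of `v`. -/
noncomputable def shrink (G : SimpleGraph V) (C : Finset V) (a : V × Bool) : Finset V :=
  if a.2 then {u ∈ C | ¬ G.Adj a.1 u} else {u ∈ C | degInto G C u ≤ degInto G C a.1}

/-- The container determined by a word of picked and dropped vertices. -/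
noncomputable def container [Fintype V] (G : SimpleGraph V) (w : List (V × Bool)) : Finset V :=
  w.foldl (shrink G) univ

variable {G : SimpleGraph V}

@[simp] lemma container_nil [Fintype V] : container G [] = univ := rfl

lemma container_concat [Fintype V] (w : List (V × Bool)) (a : V × Bool) :
    container G (w ++ [a]) = shrink G (container G w) a := by
  simp [container]

/-- Layering by degree: vertices lying above level `k - 1` are charged the next threshold `D k`. -/
lemma adjPairs_le_sum_thresholds {A C : Finset V} (D : ℕ → ℕ) (m : ℕ)
    (h : ∀ u ∈ A, degInto G C u ≤ D m) :
    adjPairs G A C ≤ ∑ k ∈ range (m + 1),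
      #{u ∈ A | k = 0 ∨ D (k - 1) < degInto G C u} * D k := by
  calc adjPairs G A C ≤ ∑ u ∈ A, ∑ k ∈ range (m + 1),
        (if k = 0 ∨ D (k - 1) < degInto G C u then D k else 0) :=
        sum_le_sum fun u hu => le_sum_of_thresholds D m _ (h u hu)
    _ = _ := by
      rw [sum_comm]
      refine sum_congr rfl fun k _ => ?_
      rw [← sum_filter, sum_const, smul_eq_mul]

end containers

/-- A sparse vertex set `J` in a graph that is far from having an independent set of density `ρ`,
with the parameters of the container algorithm, under the assumption that no pair of
short words over `J` yields a container that is small and contains most of `J`. -/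
structure SparseSetting (V : Type*) [Fintype V] [DecidableEq V] where
  G : SimpleGraph V
  J : Finset V
  (ρ ε μ s A η : ℝ)
  (I α : ℕ)
  ρ_pos : 0 < ρ
  ρ_le_one : ρ ≤ 1
  ε_pos : 0 < ε
  ε_le : ε ≤ ρ ^ 2
  μ_pos : 0 < μ
  s_pos : 0 < s
  -- The last scale `κ = ρ / 2 ^ I` satisfies `κ ρ ≤ ε / 8`, so adding about `κ n` arbitrary
  -- vertices to a set of density `ρ` is harmless.
  le_two_pow_I : 8 * ρ ^ 2 ≤ ε * 2 ^ I
  -- `A` exceeds the total range of the potential, so a run at scale `κ` costs only a small fraction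
  -- of `κ`.
  log_le_A : 20 * (Real.log (2 ^ I / ρ) + 1) ≤ A
  A_le_two_pow : 8 * A ≤ 2 ^ α
  two_pow_le_A : 2 ^ α ≤ 16 * A
  μ_le : 20000 * A ^ 2 * (I + α + 1) * μ ≤ ε
  cost_le : 8 * μ / ρ ≤ ρ / 2 ^ (I + α + 1)
  -- `η` absorbs the rounding of the size of `J`, and `card_V` absorbs that of `⌈ρ n⌉`.
  η_le : η ≤ ρ / 2 ^ I / 20
  card_V : 4 ≤ ρ / 2 ^ I * Fintype.card V
  far : ∀ B : Finset V, ρ * Fintype.card V ≤ #B → 2 * ε * (Fintype.card V : ℝ) ^ 2 ≤ adjPairs G B B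
  sparse : (adjPairs G J J : ℝ) ≤ 4 * μ * s ^ 2
  le_card_J : (ρ - η) * s ≤ #J
  card_J_le : #J ≤ ρ * s
  noContainer : ∀ w₁ w₂ : List (V × Bool), (∀ a ∈ w₁, a.1 ∈ J) → (∀ a ∈ w₂, a.1 ∈ J) →
    ρ / 2 ^ I ≤ ρ - #(container G w₁ ∩ container G w₂) / Fintype.card V →
    8 * μ / ρ * (w₁.length + w₂.length) ≤
      ρ - #(container G w₁ ∩ container G w₂) / Fintype.card V →
    (ρ - #(container G w₁ ∩ container G w₂) / Fintype.card V) * s / 2 <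
      ρ * s - #(J ∩ (container G w₁ ∩ container G w₂))

/-! ### Affordable words and the total cost of a run -/

namespace SparseSetting

variable {V : Type*} [Fintype V] [DecidableEq V] (X : SparseSetting V)

/-- The scale of the `i`-th run of the container algorithm. -/
noncomputable def scale (i : ℕ) : ℝ := X.ρ / 2 ^ i

/-- The density of a set of vertices. -/
noncomputable def dens (_X : SparseSetting V) (C : Finset V) : ℝ := #C / Fintype.card V

/-- The smallest cost of a letter. -/
noncomputable def unitCost : ℝ := 8 * X.μ / X.ρ

/-- The gain-to-cost ratio required of a letter when the container is `C`. -/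
noncomputable def rate (i : ℕ) (C : Finset V) : ℝ :=
  X.A * max 1 ((X.dens C - X.ρ) / X.scale i)

lemma scale_pos (i : ℕ) : 0 < X.scale i := div_pos X.ρ_pos (by positivity)

lemma scale_succ (i : ℕ) : X.scale (i + 1) = X.scale i / 2 := by
  unfold scale; rw [pow_succ]; field_simp

lemma scale_anti {i j : ℕ} (h : i ≤ j) : X.scale j ≤ X.scale i := by
  unfold scale
  have := X.ρ_pos
  gcongr
  norm_num

lemma scale_zero : X.scale 0 = X.ρ := by simp [scale]

lemma unitCost_pos : 0 < X.unitCost := by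
  have := X.μ_pos
  have := X.ρ_pos
  unfold unitCost; positivity

lemma unitCost_le (k : ℕ) (hk : k ≤ X.I + X.α + 1) : X.unitCost ≤ X.scale k :=
  X.cost_le.trans (X.scale_anti hk)

lemma N_pos (X : SparseSetting V) : (0 : ℝ) < Fintype.card V := by
  have h := X.card_V
  have h2 := X.scale_pos X.I
  unfold scale at h2
  by_contra hn
  push Not at hn
  nlinarith

lemma one_le_two_pow_div : 1 ≤ 2 ^ X.I / X.ρ := by
  rw [one_le_div X.ρ_pos]
  exact X.ρ_le_one.trans (one_le_pow₀ (by norm_num))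

lemma A_ge : 20 ≤ X.A := by
  have := X.log_le_A
  have := Real.log_nonneg X.one_le_two_pow_div
  linarith

lemma three_le_I : 3 ≤ X.I := by
  by_contra h
  push Not at h
  have h1 := X.le_two_pow_I
  have h2 : (2 : ℝ) ^ X.I ≤ 2 ^ 2 := pow_le_pow_right₀ (by norm_num) (by omega)
  have h3 := X.ε_pos
  have h4 := X.ε_le
  have h5 := X.ρ_pos
  nlinarith

lemma dens_univ : X.dens univ = 1 := by
  have := X.N_pos
  rw [dens, card_univ, div_self this.ne']

/-- A small intersection of two containers of short words misses much of `J`. -/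
lemma dens_gt_of_noContainer {w₁ w₂ : List (V × Bool)} (h₁ : ∀ a ∈ w₁, a.1 ∈ X.J)
    (h₂ : ∀ a ∈ w₂, a.1 ∈ X.J) {δ : ℝ} (hδ : X.scale X.I ≤ δ)
    (hlen : X.unitCost * (w₁.length + w₂.length) ≤ δ)
    (hJ : X.ρ * X.s - #(X.J ∩ (container X.G w₁ ∩ container X.G w₂)) ≤ δ / 2 * X.s) :
    X.ρ - δ < X.dens (container X.G w₁ ∩ container X.G w₂) := by
  by_contra hcon
  push Not at hcon
  have := X.noContainer w₁ w₂ h₁ h₂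
  unfold dens at hcon
  have hs := X.s_pos
  unfold scale at hδ
  unfold unitCost at hlen
  have h3 := this (by linarith) (by linarith)
  nlinarith

/-- The word `w` is affordable in the `i`-th run: its total cost, which bounds the loss in `J`,
is paid for by the decrease of the potential. -/
def Affordable (i : ℕ) (w : List (V × Bool)) : Prop :=
  (∀ a ∈ w, a.1 ∈ X.J) ∧ ∃ K : ℝ, X.unitCost * w.length ≤ K ∧
    X.ρ * X.s - #(X.J ∩ container X.G w) ≤ (X.η + K) * X.s ∧
    K ≤ X.scale i / X.A * (logPotential ((1 - X.ρ) / X.scale i) -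
      logPotential ((X.dens (container X.G w) - X.ρ) / X.scale i))

lemma affordable_nil (i : ℕ) : X.Affordable i [] := by
  refine ⟨by simp, 0, by simp, ?_, ?_⟩
  · have := X.le_card_J
    simp only [container_nil, inter_univ]
    linarith
  · simp [container_nil, dens_univ]

/-- A gain of at least `rate * q` lowers the potential enough to pay for `q`. Requiring `q` to be at
least `unitCost` makes the total cost control the length as well. -/
lemma affordable_concat {i : ℕ} {w : List (V × Bool)} (hw : X.Affordable i w) {a : V × Bool}
    (ha : a.1 ∈ X.J) {q : ℝ} (hq : X.unitCost ≤ q)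
    (hloss : (#(X.J ∩ container X.G w) : ℝ) - #(X.J ∩ shrink X.G (container X.G w) a) ≤ q * X.s)
    (hgain : X.rate i (container X.G w) * q ≤
      X.dens (container X.G w) - X.dens (shrink X.G (container X.G w) a)) :
    X.Affordable i (w ++ [a]) := by
  obtain ⟨hJ, K, h1, h2, h3⟩ := hw
  have hκ := X.scale_pos i
  have hA : 0 < X.A := by linarith [X.A_ge]
  have hq0 : 0 < q := X.unitCost_pos.trans_le hq
  refine ⟨?_, K + q, ?_, ?_, ?_⟩
  · intro b hb
    rw [List.mem_append, List.mem_singleton] at hb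
    rcases hb with hb | rfl
    exacts [hJ b hb, ha]
  · rw [List.length_append, List.length_singleton]
    push_cast
    linarith
  · rw [container_concat]
    linarith
  · rw [container_concat]
    set x := X.dens (container X.G w)
    set x' := X.dens (shrink X.G (container X.G w) a)
    have hr : 0 < max 1 ((x - X.ρ) / X.scale i) := lt_max_of_lt_left one_pos
    unfold rate at hgain
    have hxx : x' ≤ x := by
      have : 0 ≤ X.A * max 1 ((x - X.ρ) / X.scale i) * q := by positivity
      linarith
    have key := sub_div_max_le_logPotential_sub
      (z := (x - X.ρ) / X.scale i) (z' := (x' - X.ρ) / X.scale i) (by gcongr)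
    have h5 : q ≤ X.scale i / X.A * (((x - X.ρ) / X.scale i - (x' - X.ρ) / X.scale i) /
        max 1 ((x - X.ρ) / X.scale i)) := by
      have e : X.scale i / X.A * (((x - X.ρ) / X.scale i - (x' - X.ρ) / X.scale i) /
        max 1 ((x - X.ρ) / X.scale i)) = (x - x') / (X.A * max 1 ((x - X.ρ) / X.scale i)) := by
        rw [← sub_div]
        set r := max 1 ((x - X.ρ) / X.scale i)
        field_simp
        ring
      rw [e, le_div_iff₀ (by positivity)]
      linarith
    have h6 := mul_le_mul_of_nonneg_left key (show 0 ≤ X.scale i / X.A by positivity)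
    linarith

/-- The initial potential is at most `A / 20 - 1`, so `K` is at most `scale i / 20` plus `1 / 20` of
any deficit of the container below `ρ`. If that deficit `δ` reached `scale i`, both the length and
the loss in `J` would be within the limits of `noContainer`, which is a contradiction. Hence the
deficit stays below `scale i`, and the stated bounds follow. -/
lemma affordable_bounds {i : ℕ} (hi : i ≤ X.I) {w : List (V × Bool)}
    (hw : X.Affordable i w) : X.ρ - X.scale i < X.dens (container X.G w) ∧
      X.unitCost * w.length ≤ X.scale i / 10 ∧
      X.ρ * X.s - #(X.J ∩ container X.G w) ≤ X.scale i / 5 * X.s := by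
  obtain ⟨hJ, K, h1, h2, h3⟩ := hw
  have hκ := X.scale_pos i
  have hκI := X.scale_pos X.I
  have hle := X.scale_anti hi
  have hA := X.A_ge
  have hA0 : 0 < X.A := by linarith
  have hs := X.s_pos
  have hη : X.η ≤ X.scale X.I / 20 := X.η_le
  have hlog := X.log_le_A
  set x := X.dens (container X.G w) with hx
  have hK : K ≤ X.scale i / 20 + max 0 (X.ρ - x) / 20 := by
    have e1 : logPotential ((1 - X.ρ) / X.scale i) ≤ Real.log (2 ^ X.I / X.ρ) := by
      refine logPotential_le_log ?_ X.one_le_two_pow_div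
      have : (2 : ℝ) ^ X.I / X.ρ = 1 / X.scale X.I := by
        unfold scale; rw [one_div_div]
      rw [this]
      gcongr
      linarith [X.ρ_pos]
    have e2 := neg_logPotential_le ((x - X.ρ) / X.scale i)
    have e3 : max 0 (-((x - X.ρ) / X.scale i)) = max 0 (X.ρ - x) / X.scale i := by
      rw [← max_div_div_right hκ.le]
      congr 1
      · simp
      · ring
    rw [e3] at e2
    have e4 : X.scale i / X.A * (logPotential ((1 - X.ρ) / X.scale i) -
      logPotential ((x - X.ρ) / X.scale i)) ≤
        X.scale i / X.A * (X.A / 20 + max 0 (X.ρ - x) / X.scale i) := by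
      gcongr
      linarith
    have e5 : X.scale i / X.A * (X.A / 20 + max 0 (X.ρ - x) / X.scale i) =
        X.scale i / 20 + max 0 (X.ρ - x) / X.A := by
      field_simp
    have e6 : max 0 (X.ρ - x) / X.A ≤ max 0 (X.ρ - x) / 20 := by gcongr
    linarith
  have hx : X.ρ - X.scale i < x := by
    by_contra hcon
    push Not at hcon
    have hmax : max 0 (X.ρ - x) = X.ρ - x := max_eq_right (by linarith)
    rw [hmax] at hK
    have := X.dens_gt_of_noContainer (w₁ := w) (w₂ := []) hJ (by simp) (δ := X.ρ - x)
      (by linarith) (by simp only [List.length_nil, Nat.cast_zero, add_zero]; linarith)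
      (by
        rw [container_nil, inter_univ]
        refine h2.trans ?_
        gcongr
        linarith)
    rw [container_nil, inter_univ] at this
    linarith
  have hK' : K ≤ X.scale i / 10 := by
    have : max 0 (X.ρ - x) ≤ X.scale i := max_le hκ.le (by linarith)
    linarith
  refine ⟨hx, h1.trans hK', h2.trans ?_⟩
  gcongr
  linarith

end SparseSetting

section shrink

variable {V : Type*} {G : SimpleGraph V}

lemma card_shrink_pick (C : Finset V) (v : V) :
    #(shrink G C (v, true)) + degInto G C v = #C := by
  classical
  rw [shrink, if_pos rfl, degInto, add_comm, card_filter_add_card_filter_not]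

lemma shrink_drop (C : Finset V) (v : V) :
    shrink G C (v, false) = {u ∈ C | degInto G C u ≤ degInto G C v} := by
  simp [shrink]

lemma card_shrink_drop (C : Finset V) (v : V) :
    #(shrink G C (v, false)) + #{u ∈ C | degInto G C v < degInto G C u} = #C := by
  rw [shrink_drop]
  simp only [← not_le]
  exact card_filter_add_card_filter_not _

variable [DecidableEq V]

lemma card_inter_shrink_pick (B C : Finset V) (v : V) :
    #(B ∩ C) ≤ #(B ∩ shrink G C (v, true)) + degInto G B v := by
  classical
  rw [shrink, if_pos rfl, degInto]
  refine (card_le_card fun u hu => ?_).trans (card_union_le _ _)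
  simp only [mem_inter, mem_union, mem_filter] at *
  tauto

lemma card_inter_shrink_drop (B C : Finset V) (v : V) :
    #(B ∩ C) = #(B ∩ shrink G C (v, false)) +
      #{u ∈ B ∩ C | degInto G C v < degInto G C u} := by
  simp only [shrink_drop, inter_filter, ← not_le]
  exact (card_filter_add_card_filter_not
    (s := B ∩ C) (fun u => degInto G C u ≤ degInto G C v)).symm

end shrink

/-! ### Terminal words -/

namespace SparseSetting

variable {V : Type*} [Fintype V] [DecidableEq V] (X : SparseSetting V)

/-- A run at scale `i` can be continued until no letter is cheap enough. -/
lemma exists_terminal {i : ℕ} (hi : i ≤ X.I) : ∃ w, X.Affordable i w ∧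
    ∀ k ≤ i + X.α, ∀ D : ℕ,
      X.scale (k + 1) * X.s ≤
        #{v ∈ X.J ∩ container X.G w | D ≤ degInto X.G (container X.G w) v} →
      (#{v ∈ X.J ∩ container X.G w | D < degInto X.G (container X.G w) v} : ℝ) <
        X.scale (k + 1) * X.s →
      (D : ℝ) / Fintype.card V < X.rate i (container X.G w) * (4 * X.μ / X.scale (k + 1)) ∧
      X.dens {u ∈ container X.G w | D < degInto X.G (container X.G w) u} <
        X.rate i (container X.G w) * X.scale (k + 1) := by
  classical
  have hN := X.N_pos
  have hs := X.s_pos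
  -- Take an affordable word with the smallest container: an affordable extension would have a
  -- strictly positive gain.
  have hex : ∃ c, ∃ w, X.Affordable i w ∧ #(container X.G w) = c := ⟨_, [], X.affordable_nil i, rfl⟩
  obtain ⟨w, hw, hwc⟩ := Nat.find_spec hex
  have hmin : ∀ a : V × Bool, X.Affordable i (w ++ [a]) →
      #(container X.G w) ≤ #(shrink X.G (container X.G w) a) := by
    intro a ha
    rw [hwc, ← container_concat]
    exact Nat.find_min' hex ⟨_, ha, rfl⟩
  refine ⟨w, hw, fun k hk D h1 h2 => ?_⟩
  set C := container X.G w with hC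
  have hy := X.scale_pos (k + 1)
  have hrate : 0 < X.rate i C :=
    mul_pos (by linarith [X.A_ge]) (lt_max_of_lt_left one_pos)
  have hneg : ∀ (a : V × Bool), a.1 ∈ X.J → ∀ q : ℝ, X.unitCost ≤ q →
      (#(X.J ∩ C) : ℝ) - #(X.J ∩ shrink X.G C a) ≤ q * X.s →
      X.dens C - X.dens (shrink X.G C a) < X.rate i C * q := by
    intro a ha q hq hl
    by_contra hg
    push Not at hg
    have h5 := hmin a (X.affordable_concat hw ha hq hl hg)
    have h6 : 0 < X.rate i C * q := mul_pos hrate (X.unitCost_pos.trans_le hq)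
    have h7 : X.dens C ≤ X.dens (shrink X.G C a) := by unfold dens; gcongr
    linarith
  have hPpos : (0 : ℝ) < #{v ∈ X.J ∩ C | D ≤ degInto X.G C v} := by
    have : 0 < X.scale (k + 1) * X.s := by positivity
    linarith
  constructor
  -- At least `scale (k + 1) * s` vertices of `J` have degree at least `D` into `C`, and together
  -- they have at most `4 μ s²` adjacencies into `J`. One of them therefore has few neighbours in
  -- `J`. Picking it would be a cheap letter that removes at least `D` vertices of `C`.
  · have hPne : ({v ∈ X.J ∩ C | D ≤ degInto X.G C v} : Finset V).Nonempty := by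
      rw [← card_pos]; exact_mod_cast hPpos
    obtain ⟨v, hv, hvJ⟩ := exists_le_of_sum_le (f := fun v => (degInto X.G X.J v : ℝ))
      (g := fun _ => 4 * X.μ / X.scale (k + 1) * X.s) hPne (by
        rw [sum_const, nsmul_eq_mul]
        calc ∑ v ∈ X.J ∩ C with D ≤ degInto X.G C v, (degInto X.G X.J v : ℝ)
            ≤ adjPairs X.G X.J X.J := by
              rw [adjPairs]
              push_cast
              refine sum_le_sum_of_subset_of_nonneg ?_ fun _ _ _ => by positivity
              exact (filter_subset _ _).trans inter_subset_left
          _ ≤ 4 * X.μ * X.s ^ 2 := X.sparse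
          _ = X.scale (k + 1) * X.s * (4 * X.μ / X.scale (k + 1) * X.s) := by field_simp
          _ ≤ _ := by
            have := X.μ_pos
            gcongr)
    rw [mem_filter, mem_inter] at hv
    have hg := hneg (v, true) hv.1.1 (4 * X.μ / X.scale (k + 1)) (by
        have h8 : X.scale (k + 1) ≤ X.ρ / 2 := by
          have := X.scale_anti (show 1 ≤ k + 1 by omega)
          simpa [scale] using this
        have := X.ρ_pos
        have := X.μ_pos
        unfold unitCost
        rw [div_le_div_iff₀ (by positivity) hy]
        nlinarith) (by
        have := card_inter_shrink_pick (G := X.G) X.J C v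
        have : (#(X.J ∩ C) : ℝ) ≤ #(X.J ∩ shrink X.G C (v, true)) + degInto X.G X.J v := by
          exact_mod_cast this
        linarith)
    refine lt_of_le_of_lt ?_ hg
    have h9 : (#(shrink X.G C (v, true)) : ℝ) + degInto X.G C v = #C := by
      exact_mod_cast card_shrink_pick C v
    have h10 : (D : ℝ) ≤ degInto X.G C v := by exact_mod_cast hv.2
    unfold dens
    rw [← sub_div]
    gcongr
    linarith
  -- The count crosses at `D`, so `D` is the degree of some vertex of `J`. The drop letter of that
  -- vertex loses fewer than `scale (k + 1) * s` vertices of `J`.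
  · obtain ⟨v, hv, hvD⟩ : ∃ v ∈ X.J ∩ C, degInto X.G C v = D := by
      by_contra hcon
      push Not at hcon
      have : ({v ∈ X.J ∩ C | D ≤ degInto X.G C v} : Finset V) =
          {v ∈ X.J ∩ C | D < degInto X.G C v} :=
        filter_congr fun v hv => ⟨fun h => lt_of_le_of_ne h (hcon v hv).symm, le_of_lt⟩
      rw [this] at h1
      linarith
    rw [mem_inter] at hv
    have hg := hneg (v, false) hv.1 (X.scale (k + 1)) (X.unitCost_le _ (by omega)) (by
        have := card_inter_shrink_drop (G := X.G) X.J C v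
        rw [hvD] at this
        have h9 : (#(X.J ∩ C) : ℝ) = #(X.J ∩ shrink X.G C (v, false)) +
          #{u ∈ X.J ∩ C | D < degInto X.G C u} := by exact_mod_cast this
        linarith)
    refine lt_of_le_of_lt (le_of_eq ?_) hg
    have := card_shrink_drop (G := X.G) C v
    rw [hvD] at this
    have h9 : (#(shrink X.G C (v, false)) : ℝ) + #{u ∈ C | D < degInto X.G C u} = #C := by
      exact_mod_cast this
    unfold dens
    rw [← sub_div]
    congr 1
    linarith

/-- The outcome of a run at scale `i`: a word together with degree thresholds `D k` that are
attained on `J`, are small, and are exceeded by few vertices of the container. -/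
structure Terminal (i : ℕ) (w : List (V × Bool)) (D : ℕ → ℕ) : Prop where
  affordable : X.Affordable i w
  attained : ∀ k ≤ i + X.α, ∃ v ∈ X.J, degInto X.G (container X.G w) v = D k
  mono : ∀ k ≤ i + X.α, D k ≤ D (i + X.α)
  card_lt : ∀ k ≤ i + X.α, (#{v ∈ X.J ∩ container X.G w |
    D k < degInto X.G (container X.G w) v} : ℝ) < X.scale (k + 1) * X.s
  threshold_lt : ∀ k ≤ i + X.α,
    (D k : ℝ) < X.rate i (container X.G w) * (4 * X.μ / X.scale (k + 1)) * Fintype.card V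
  above_lt : ∀ k ≤ i + X.α,
    (#{u ∈ container X.G w | D k < degInto X.G (container X.G w) u} : ℝ) <
      X.rate i (container X.G w) * X.scale (k + 1) * Fintype.card V

lemma exists_isTerminal {i : ℕ} (h3 : 1 ≤ i) (hi : i ≤ X.I) : ∃ w D, X.Terminal i w D := by
  obtain ⟨w, hw, h⟩ := X.exists_terminal hi
  have hN := X.N_pos
  have hs := X.s_pos
  set C := container X.G w with hC
  have hex : ∀ k, ∃ D : ℕ, X.scale (k + 1) * X.s ≤ #{v ∈ X.J ∩ C | D ≤ degInto X.G C v} ∧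
      (#{v ∈ X.J ∩ C | D < degInto X.G C v} : ℝ) < X.scale (k + 1) * X.s := by
    intro k
    refine exists_threshold _ _ (mul_pos (X.scale_pos _) hs) ?_
    have h1 := (X.affordable_bounds hi hw).2.2
    have h2 : X.scale (k + 1) ≤ X.ρ / 2 := by
      have := X.scale_anti (show 1 ≤ k + 1 by omega)
      simpa [scale] using this
    have h4 : X.scale i ≤ X.ρ / 2 := by
      have := X.scale_anti h3
      simpa [scale] using this
    have h5 := X.ρ_pos
    have h6 : (X.scale (k + 1) + X.scale i / 5) * X.s ≤ X.ρ * X.s := by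
      gcongr
      linarith
    linarith
  choose D hD1 hD2 using hex
  refine ⟨w, D, hw, ?_, ?_, fun k _ => hD2 k, ?_, ?_⟩
  · intro k _
    by_contra hcon
    push Not at hcon
    have : ({v ∈ X.J ∩ C | D k ≤ degInto X.G C v} : Finset V) =
        {v ∈ X.J ∩ C | D k < degInto X.G C v} :=
      filter_congr fun v hv => ⟨fun h => lt_of_le_of_ne h (hcon v (mem_inter.1 hv).1).symm, le_of_lt⟩
    have h1 := hD1 k
    rw [this] at h1
    linarith [hD2 k]
  -- Smaller `k` means a larger quantile, hence a threshold no higher than the last one.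
  · intro k hk
    by_contra hcon
    push Not at hcon
    have h1 : (#{v ∈ X.J ∩ C | D k ≤ degInto X.G C v} : ℝ) ≤
        #{v ∈ X.J ∩ C | D (i + X.α) < degInto X.G C v} := by
      gcongr with v hv
    have h2 : X.scale (i + X.α + 1) * X.s ≤ X.scale (k + 1) * X.s := by
      gcongr
      exact X.scale_anti (by omega)
    linarith [hD1 k, hD2 (i + X.α)]
  · intro k hk
    exact (div_lt_iff₀ hN).1 (h k hk (D k) (hD1 k) (hD2 k)).1
  · intro k hk
    exact (div_lt_iff₀ hN).1 (h k hk (D k) (hD1 k) (hD2 k)).2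

end SparseSetting

/-! ### Induction on the scales -/

namespace SparseSetting

variable {V : Type*} [Fintype V] [DecidableEq V] {X : SparseSetting V}

/-- Since `D k` is attained on `J`, one extra drop letter cuts the container at this threshold. The
low-degree part is thus itself a container, and `noContainer` applies to it. -/
lemma Terminal.exists_word {i : ℕ} (hi : i ≤ X.I) {w : List (V × Bool)} {D : ℕ → ℕ}
    (h : X.Terminal i w D) {k : ℕ} (hk : k ≤ i + X.α) :
    ∃ w' : List (V × Bool), (∀ a ∈ w', a.1 ∈ X.J) ∧
      container X.G w' = {u ∈ container X.G w | degInto X.G (container X.G w) u ≤ D k} ∧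
      X.unitCost * w'.length ≤ X.scale i / 4 ∧
      X.ρ * X.s - #(X.J ∩ container X.G w') ≤ (X.scale i / 5 + X.scale (k + 1)) * X.s := by
  obtain ⟨v, hvJ, hv⟩ := h.attained k hk
  obtain ⟨h1, h2, h3⟩ := X.affordable_bounds hi h.affordable
  have hE : container X.G (w ++ [(v, false)]) =
      {u ∈ container X.G w | degInto X.G (container X.G w) u ≤ D k} := by
    rw [container_concat, shrink_drop, hv]
  refine ⟨w ++ [(v, false)], ?_, hE, ?_, ?_⟩
  · intro a ha
    rw [List.mem_append, List.mem_singleton] at ha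
    rcases ha with ha | rfl
    exacts [h.affordable.1 a ha, hvJ]
  · have h4 := X.unitCost_le (i + X.α + 1) (by omega)
    have h5 : X.scale (i + X.α + 1) ≤ X.scale i / 16 := by
      have h6 : X.scale (i + X.α + 1) = X.scale i / 2 ^ (X.α + 1) := by
        unfold scale; rw [div_div, ← pow_add, add_assoc]
      rw [h6]
      have := X.scale_pos i
      have := X.A_le_two_pow
      have := X.A_ge
      gcongr
      rw [pow_succ]
      linarith
    rw [List.length_append, List.length_singleton]
    push_cast
    linarith [X.scale_pos i]
  · have h4 := card_inter_shrink_drop (G := X.G) X.J (container X.G w) v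
    rw [hv] at h4
    have h5 := h.card_lt k hk
    have h6 : (#(X.J ∩ container X.G w) : ℝ) = #(X.J ∩ shrink X.G (container X.G w) (v, false)) +
      #{u ∈ X.J ∩ container X.G w | D k < degInto X.G (container X.G w) u} := by
      exact_mod_cast h4
    rw [container_concat]
    linarith

lemma rate_pos (i : ℕ) (C : Finset V) : 0 < X.rate i C :=
  mul_pos (by linarith [X.A_ge]) (lt_max_of_lt_left one_pos)

lemma Terminal.adjPairs_le {i : ℕ} {w : List (V × Bool)} {D : ℕ → ℕ}
    (h : X.Terminal i w D) {A : Finset V}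
    (hA : ∀ u ∈ A, degInto X.G (container X.G w) u ≤ D (i + X.α)) {b : ℕ → ℝ}
    (hb : ∀ k ≤ i + X.α,
      (#{u ∈ A | k = 0 ∨ D (k - 1) < degInto X.G (container X.G w) u} : ℝ) ≤
        b k * Fintype.card V) :
    (adjPairs X.G A (container X.G w) : ℝ) ≤
      (∑ k ∈ range (i + X.α + 1), b k / X.scale (k + 1)) *
        (4 * X.μ * X.rate i (container X.G w) * (Fintype.card V : ℝ) ^ 2) := by
  have h1 : (adjPairs X.G A (container X.G w) : ℝ) ≤ ∑ k ∈ range (i + X.α + 1),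
      (#{u ∈ A | k = 0 ∨ D (k - 1) < degInto X.G (container X.G w) u} : ℝ) * D k := by
    exact_mod_cast adjPairs_le_sum_thresholds D (i + X.α) hA
  refine h1.trans ?_
  rw [sum_mul]
  refine sum_le_sum fun k hk => ?_
  have hk : k ≤ i + X.α := by rw [mem_range] at hk; omega
  have hN := X.N_pos
  have h2 := hb k hk
  have h3 := (h.threshold_lt k hk).le
  calc _ ≤ (b k * Fintype.card V) *
        (X.rate i (container X.G w) * (4 * X.μ / X.scale (k + 1)) * Fintype.card V) :=
        mul_le_mul h2 h3 (by positivity) (le_trans (by positivity) h2)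
    _ = _ := by ring

/-- For `k = 0` this bounds the whole container: its density is at most `ρ + r * scale i ≤ 2 r ρ`,
where `r` is the maximum in `rate`, and `A ≥ 20`. -/
lemma Terminal.card_above_le {i : ℕ} {w : List (V × Bool)} {D : ℕ → ℕ}
    (h : X.Terminal i w D) {k : ℕ} (hk : k ≤ i + X.α) :
    (#{u ∈ container X.G w | k = 0 ∨ D (k - 1) < degInto X.G (container X.G w) u} : ℝ) ≤
      X.rate i (container X.G w) * X.scale k * Fintype.card V := by
  rcases k with _ | k
  · simp only [true_or, filter_true, scale_zero]
    have hN := X.N_pos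
    have hκ := X.scale_pos i
    have hρ := X.ρ_pos
    have hκρ : X.scale i ≤ X.ρ := by
      have := X.scale_anti (Nat.zero_le i)
      rwa [scale_zero] at this
    have e : (#(container X.G w) : ℝ) = X.dens (container X.G w) * Fintype.card V := by
      rw [dens]; field_simp
    rw [e]
    gcongr
    set x := X.dens (container X.G w)
    have h1 := le_max_left 1 ((x - X.ρ) / X.scale i)
    have h2 := le_max_right 1 ((x - X.ρ) / X.scale i)
    set r := max 1 ((x - X.ρ) / X.scale i) with hr
    rw [div_le_iff₀ hκ] at h2
    have h3 : x ≤ 2 * (r * X.ρ) := by nlinarith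
    have h4 : 20 * (r * X.ρ) ≤ X.A * (r * X.ρ) := by
      have := X.A_ge
      gcongr
    have h5 : X.rate i (container X.G w) = X.A * r := rfl
    rw [h5]
    have : 0 ≤ r * X.ρ := by positivity
    linarith
  · simpa using (h.above_lt k (by omega)).le

/-- A level set of size `R * scale k` is charged a degree proportional to `R μ / scale (k + 1)`. The
scales cancel, so each of the `i + α + 1` levels contributes the same amount. -/
lemma Terminal.adjPairs_container_le {i : ℕ} {w : List (V × Bool)} {D : ℕ → ℕ}
    (h : X.Terminal i w D) {A : Finset V} (hAC : A ⊆ container X.G w)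
    (hA : ∀ u ∈ A, degInto X.G (container X.G w) u ≤ D (i + X.α)) :
    (adjPairs X.G A (container X.G w) : ℝ) ≤
      8 * (i + X.α + 1) * X.rate i (container X.G w) ^ 2 * X.μ * (Fintype.card V : ℝ) ^ 2 := by
  have hR := rate_pos (X := X) i (container X.G w)
  refine (h.adjPairs_le hA (b := fun k => X.rate i (container X.G w) * X.scale k)
    fun k hk => le_trans ?_ (h.card_above_le hk)).trans (le_of_eq ?_)
  · gcongr
  · have : ∀ k ∈ range (i + X.α + 1), X.rate i (container X.G w) * X.scale k / X.scale (k + 1) =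
        2 * X.rate i (container X.G w) := by
      intro k _
      have := X.scale_pos k
      rw [scale_succ]
      field_simp
    rw [sum_congr rfl this, sum_const, card_range, nsmul_eq_mul]
    push_cast
    ring

/-- A geometric sum dominated by its last term, of order `2 ^ α`; this is why `2 ^ α` must also be
bounded above by a multiple of `A`. -/
lemma sum_inv_scale_le (i : ℕ) :
    ∑ k ∈ range (i + X.α + 1), X.scale i / X.scale (k + 1) ≤ 64 * X.A := by
  have hρ := X.ρ_pos
  have h1 : ∀ k ∈ range (i + X.α + 1), X.scale i / X.scale (k + 1) = 2 / 2 ^ i * 2 ^ k := by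
    intro k _
    unfold scale
    rw [pow_succ]
    field_simp
  rw [sum_congr rfl h1, ← mul_sum, geom_sum_eq (by norm_num)]
  have h2 := X.two_pow_le_A
  have h3 : (2 : ℝ) / 2 ^ i * ((2 ^ (i + X.α + 1) - 1) / (2 - 1)) = 4 * 2 ^ X.α - 2 / 2 ^ i := by
    rw [pow_succ, pow_add]
    field_simp
    ring
  rw [h3]
  have : (0 : ℝ) ≤ 2 / 2 ^ i := by positivity
  linarith

lemma le_ceil_mul_card_V : ⌈X.ρ * Fintype.card V⌉₊ ≤ Fintype.card V :=
  Nat.ceil_le.2 (mul_le_of_le_one_left X.N_pos.le X.ρ_le_one)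

lemma sq_A_mul_le {i : ℕ} (hi : i ≤ X.I) :
    X.A ^ 2 * (i + X.α + 1) * X.μ ≤ X.ε / 20000 := by
  have h1 := X.μ_le
  have h2 : X.A ^ 2 * (i + X.α + 1) * X.μ ≤ X.A ^ 2 * (X.I + X.α + 1) * X.μ := by
    have := X.μ_pos
    gcongr
  linarith

set_option maxHeartbeats 1000000 in
/-- If the terminal container is much larger than `ρ n`, then a nearly complete sparse subset of
its low-degree part extends to a sparse set of density `ρ`, which is impossible. -/
lemma Terminal.not_subset {i : ℕ} (hi : i ≤ X.I) {w : List (V × Bool)} {D : ℕ → ℕ}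
    (h : X.Terminal i w D) (hg : X.scale i < X.dens (container X.G w) - X.ρ) {B : Finset V}
    (hBC : B ⊆ {u ∈ container X.G w | degInto X.G (container X.G w) u ≤ D (i + X.α)})
    (hB : (#B : ℝ) ≤ X.ρ * Fintype.card V)
    (hB' : (X.ρ - 8 * X.scale i) * Fintype.card V ≤ #B)
    (hBB : (adjPairs X.G B B : ℝ) ≤ X.ε * (Fintype.card V : ℝ) ^ 2)
    (hBD : ∀ k < i + X.α, (#{u ∈ B | D k < degInto X.G (container X.G w) u} : ℝ) ≤
      (2 * X.scale i + 2 * X.scale (k + 1)) * Fintype.card V) : False := by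
  have hN := X.N_pos
  have hκ := X.scale_pos i
  have hρ := X.ρ_pos
  have hμ := X.μ_pos
  have hA := X.A_ge
  have hA0 : 0 < X.A := by linarith
  have hκN : 4 ≤ X.scale i * Fintype.card V := by
    have h1 := X.card_V
    have h2 : X.scale X.I * Fintype.card V ≤ X.scale i * Fintype.card V := by
      have := X.scale_anti hi
      gcongr
    unfold scale at h2 ⊢
    linarith
  set C := container X.G w with hC
  set N : ℝ := (Fintype.card V : ℝ) with hNdef
  set g := X.dens C - X.ρ with hgdef
  have hg0 : 0 < g := hκ.trans hg
  set R := X.rate i C with hR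
  have hRg : R = X.A * (g / X.scale i) := by
    rw [hR, rate, max_eq_right]
    rw [one_le_div hκ]
    exact hg.le
  have hR0 : 0 < R := rate_pos i C
  set E := ({u ∈ C | degInto X.G C u ≤ D (i + X.α)} : Finset V) with hE
  have hEcard : (X.ρ + 15 / 16 * g) * N ≤ #E := by
    have h1 := (h.above_lt (i + X.α) le_rfl).le
    have h2 : (#E : ℝ) + #{u ∈ C | D (i + X.α) < degInto X.G C u} = #C := by
      rw [hE]
      simp only [← not_le]
      exact_mod_cast card_filter_add_card_filter_not _
    have h3 : (#C : ℝ) = (X.ρ + g) * N := by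
      rw [hgdef, dens, ← hNdef]; field_simp; ring
    -- Here `2 ^ α ≥ 8 A` is needed: cutting at the last threshold costs only a small part of the
    -- excess `g`.
    have h4 : R * X.scale (i + X.α + 1) ≤ g / 16 := by
      have h6 : X.scale (i + X.α + 1) = X.scale i / 2 ^ (X.α + 1) := by
        unfold scale; rw [div_div, ← pow_add, add_assoc]
      have h7 : X.A * (g / X.scale i) * (X.scale i / 2 ^ (X.α + 1)) =
        X.A * g / 2 ^ (X.α + 1) := by field_simp
      rw [h6, hRg, h7, div_le_iff₀ (by positivity), pow_succ]
      have := X.A_le_two_pow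
      nlinarith
    have h5 := mul_le_mul_of_nonneg_right h4 hN.le
    rw [← hC, ← hR] at h1
    linarith
  set n₁ := ⌈X.ρ * N⌉₊ with hn₁
  have hn1 : (n₁ : ℝ) < X.ρ * N + 1 := Nat.ceil_lt_add_one (by positivity)
  have hn1' : X.ρ * N ≤ n₁ := Nat.le_ceil _
  have hBn : #B ≤ n₁ := by
    have : (#B : ℝ) ≤ n₁ := hB.trans hn1'
    exact_mod_cast this
  set U := E \ B with hU
  have hUcard : (#U : ℝ) = #E - #B := by
    rw [hU, card_sdiff_of_subset hBC, Nat.cast_sub (card_le_card hBC)]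
  have hUge : 15 / 16 * g * N ≤ #U := by rw [hUcard]; linarith
  have hgN : X.scale i * N ≤ g * N := by gcongr
  have hU0 : (0 : ℝ) < #U := by nlinarith
  have hw0 : ((n₁ - #B : ℕ) : ℝ) = n₁ - #B := by rw [Nat.cast_sub hBn]
  have hwle : n₁ - #B ≤ #U := by
    have : ((n₁ - #B : ℕ) : ℝ) ≤ #U := by rw [hw0, hUcard]; nlinarith
    exact_mod_cast this
  obtain ⟨W, hWU, hWcard, hW⟩ := exists_subset_adjPairs_le (G := X.G) B hwle
  rw [hw0] at hW
  set t := ((n₁ : ℝ) - #B) / #U with ht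
  have ht0 : 0 ≤ t := by
    rw [ht, ← hw0]; positivity
  -- The set `W` is a piece of `U` of relative size `t = O(scale i / g)`, whereas `R = A g / scale
  -- i`. The product does not depend on `g`. It suffices because pairs inside `U` are bounded with
  -- `R ^ 2` and weighted by `t ^ 2`, and pairs between `U` and `B` are bounded with `R` and
  -- weighted by `t`.
  have htR : t * R ≤ 10 * X.A := by
    have h1 : t ≤ 10 * X.scale i / g := by
      rw [ht, div_le_div_iff₀ hU0 hg0]
      have h2 : (n₁ : ℝ) - #B ≤ 9 * X.scale i * N := by nlinarith
      calc ((n₁ : ℝ) - #B) * g ≤ 9 * X.scale i * N * g := by gcongr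
        _ ≤ 10 * X.scale i * (15 / 16 * g * N) := by
          have : 0 ≤ X.scale i * N * g := by positivity
          linarith
        _ ≤ _ := by gcongr
    calc t * R ≤ 10 * X.scale i / g * R := by gcongr
      _ = 10 * X.A := by rw [hRg]; field_simp
  have hdisj : Disjoint B W := (disjoint_sdiff.mono_right hWU)
  have hfar := X.far (B ∪ W) (by
    rw [card_union_of_disjoint hdisj, hWcard, Nat.add_sub_cancel' hBn]
    exact hn1')
  rw [adjPairs_union_self hdisj] at hfar
  push_cast at hfar
  have hEC : E ⊆ C := filter_subset _ _
  have hElow : ∀ u ∈ E, degInto X.G C u ≤ D (i + X.α) := fun u hu => (mem_filter.1 hu).2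
  set m : ℝ := i + X.α + 1 with hm
  have hm1 : 1 ≤ m := by rw [hm]; linarith [Nat.cast_nonneg (α := ℝ) i, Nat.cast_nonneg (α := ℝ) X.α]
  -- Counting from the side of `B` saves a factor `R`: the level sets of `B` are bounded by `hBD`,
  -- without `R`.
  have hUB : (adjPairs X.G U B : ℝ) ≤ 528 * X.A * m * X.μ * R * N ^ 2 := by
    have h1 : (adjPairs X.G U B : ℝ) ≤ adjPairs X.G B C := by
      rw [adjPairs_comm]
      exact_mod_cast adjPairs_mono subset_rfl (sdiff_subset.trans hEC)
    refine h1.trans ?_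
    refine (h.adjPairs_le (A := B) (fun u hu => hElow u (hBC hu))
      (b := fun k => 2 * X.scale i + 4 * X.scale (k + 1)) ?_).trans ?_
    · intro k hk
      rcases k with _ | k
      · simp only [true_or, filter_true]
        have : X.scale (0 + 1) = X.ρ / 2 := by simp [scale]
        rw [this]
        nlinarith
      · have h2 := hBD k (by omega)
        have h3 : 4 * X.scale (k + 1 + 1) = 2 * X.scale (k + 1) := by
          rw [X.scale_succ (k + 1)]; ring
        simpa [h3] using h2
    · have h2 : ∀ k ∈ range (i + X.α + 1), (2 * X.scale i + 4 * X.scale (k + 1)) / X.scale (k + 1) =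
          2 * (X.scale i / X.scale (k + 1)) + 4 := by
        intro k _
        have := X.scale_pos (k + 1)
        field_simp
      rw [sum_congr rfl h2, sum_add_distrib, ← mul_sum, sum_const, card_range, nsmul_eq_mul]
      push_cast
      rw [← hm, ← hC, ← hR, ← hNdef]
      have h3 := sum_inv_scale_le (X := X) i
      have h4 : 2 * ∑ k ∈ range (i + X.α + 1), X.scale i / X.scale (k + 1) + m * 4 ≤
          132 * X.A * m := by nlinarith
      calc _ ≤ 132 * X.A * m * (4 * X.μ * R * N ^ 2) := by gcongr
        _ = _ := by ring
  have hUU : (adjPairs X.G U U : ℝ) ≤ 8 * m * R ^ 2 * X.μ * N ^ 2 := by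
    have h1 : (adjPairs X.G U U : ℝ) ≤ adjPairs X.G E C := by
      exact_mod_cast adjPairs_mono sdiff_subset (sdiff_subset.trans hEC)
    exact h1.trans (h.adjPairs_container_le hEC hElow)
  have h1 : 2 * (t * (adjPairs X.G U B : ℝ)) ≤ 10560 * (X.A ^ 2 * m * X.μ) * N ^ 2 := by
    calc _ ≤ 2 * (t * (528 * X.A * m * X.μ * R * N ^ 2)) := by gcongr
      _ = t * R * (1056 * X.A * m * X.μ * N ^ 2) := by ring
      _ ≤ 10 * X.A * (1056 * X.A * m * X.μ * N ^ 2) := by gcongr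
      _ = _ := by ring
  have h2 : t ^ 2 * (adjPairs X.G U U : ℝ) ≤ 800 * (X.A ^ 2 * m * X.μ) * N ^ 2 := by
    calc _ ≤ t ^ 2 * (8 * m * R ^ 2 * X.μ * N ^ 2) := by gcongr
      _ = (t * R) ^ 2 * (8 * m * X.μ * N ^ 2) := by ring
      _ ≤ (10 * X.A) ^ 2 * (8 * m * X.μ * N ^ 2) := by gcongr
      _ = _ := by ring
  have h3 : X.A ^ 2 * m * X.μ * N ^ 2 ≤ X.ε / 20000 * N ^ 2 := by
    have := sq_A_mul_le (X := X) hi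
    gcongr
  have h4 : 0 < X.ε * N ^ 2 := by
    have := X.ε_pos
    positivity
  linarith

/-- There is a sparse container that misses only a small part of `J`, at scale `i`. -/
def HasSparseContainer (X : SparseSetting V) (i : ℕ) : Prop :=
  ∃ w : List (V × Bool), (∀ a ∈ w, a.1 ∈ X.J) ∧ X.unitCost * w.length ≤ X.scale i / 4 ∧
    X.ρ * X.s - #(X.J ∩ container X.G w) ≤ X.scale i / 4 * X.s ∧
    (adjPairs X.G (container X.G w) (container X.G w) : ℝ) ≤ X.ε * (Fintype.card V : ℝ) ^ 2

/-- If the terminal container exceeds `ρ` by at most `scale i`, then `rate` equals `A` and its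
low-degree part is sparse. A larger excess is ruled out by `Terminal.not_subset`, applied to the
intersection of the low-degree part with the sparse container of the previous scale. -/
lemma hasSparseContainer_of_pred {i : ℕ} (h3 : 3 ≤ i) (hi : i ≤ X.I)
    (hpred : i = 3 ∨ X.HasSparseContainer (i - 1)) : X.HasSparseContainer i := by
  obtain ⟨w, D, h⟩ := X.exists_isTerminal (by omega) hi
  have hN := X.N_pos
  have hκ := X.scale_pos i
  have hρ := X.ρ_pos
  have hs := X.s_pos
  have hA := X.A_ge
  have hε := X.ε_pos
  rcases le_or_gt (X.dens (container X.G w) - X.ρ) (X.scale i) with hg | hg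
  · obtain ⟨w', hJ, hw', hlen, hloss⟩ := h.exists_word hi (le_refl (i + X.α))
    refine ⟨w', hJ, hlen, hloss.trans ?_, ?_⟩
    · have h6 : X.scale (i + X.α + 1) = X.scale i / 2 ^ (X.α + 1) := by
        unfold scale; rw [div_div, ← pow_add, add_assoc]
      have : X.scale (i + X.α + 1) ≤ X.scale i / 20 := by
        rw [h6]
        have := X.A_le_two_pow
        gcongr
        rw [pow_succ]
        linarith
      gcongr
      linarith
    · rw [hw']
      have hR : X.rate i (container X.G w) = X.A := by
        rw [rate, max_eq_left, mul_one]
        rwa [div_le_one hκ]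
      have h1 := h.adjPairs_container_le (filter_subset
        (fun u => degInto X.G (container X.G w) u ≤ D (i + X.α)) _)
        fun u hu => (mem_filter.1 hu).2
      rw [hR] at h1
      have h2 := sq_A_mul_le (X := X) hi
      have h4 : (adjPairs X.G
          {u ∈ container X.G w | degInto X.G (container X.G w) u ≤ D (i + X.α)}
          {u ∈ container X.G w | degInto X.G (container X.G w) u ≤ D (i + X.α)} : ℝ) ≤
          adjPairs X.G {u ∈ container X.G w | degInto X.G (container X.G w) u ≤ D (i + X.α)}
            (container X.G w) := by
        exact_mod_cast adjPairs_mono subset_rfl (filter_subset _ _)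
      refine h4.trans (h1.trans ?_)
      gcongr
      linarith
  · exfalso
    rcases hpred with rfl | ⟨w₂, hJ₂, hlen₂, hloss₂, hsp⟩
    -- At `i = 3` one has `8 * scale i = ρ`, so the lower bound on `B` is void and the induction can
    -- start from the empty set.
    · refine h.not_subset hi hg (B := ∅) (empty_subset _) ?_ ?_ ?_ ?_
      · simpa using (by positivity : (0 : ℝ) ≤ X.ρ * Fintype.card V)
      · have : X.ρ - 8 * X.scale 3 = 0 := by unfold scale; ring
        rw [this]
        simp
      · simp only [adjPairs, sum_empty, Nat.cast_zero]
        positivity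
      · intro k _
        simp only [filter_empty, card_empty, Nat.cast_zero]
        have := X.scale_pos (k + 1)
        positivity
    · have hκ2 : X.scale (i - 1) = 2 * X.scale i := by
        obtain ⟨j, rfl⟩ : ∃ j, i = j + 1 := ⟨i - 1, by omega⟩
        rw [Nat.add_sub_cancel, scale_succ]; ring
      rw [hκ2] at hlen₂ hloss₂
      -- The two containers lose at most `scale i / 5 + scale (k + 1)` and `scale i / 2` of `J`. The
      -- losses add up because `J` has at most `ρ s` vertices, and the sum stays below half of the
      -- allowed deficit.
      have hE : ∀ k ≤ i + X.α, X.ρ - (2 * X.scale i + 2 * X.scale (k + 1)) <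
          X.dens ({u ∈ container X.G w | degInto X.G (container X.G w) u ≤ D k} ∩
            container X.G w₂) := by
        intro k hk
        obtain ⟨w', hJ, hw', hlen, hloss⟩ := h.exists_word hi hk
        have hy := X.scale_pos (k + 1)
        rw [← hw']
        refine X.dens_gt_of_noContainer hJ hJ₂ ?_ ?_ ?_
        · linarith [X.scale_anti hi]
        · rw [mul_add]; linarith
        · have h1 : #(X.J ∩ container X.G w') + #(X.J ∩ container X.G w₂) ≤
              #(X.J ∩ (container X.G w' ∩ container X.G w₂)) + #X.J := by
            have e : X.J ∩ (container X.G w' ∩ container X.G w₂) =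
                (X.J ∩ container X.G w') ∩ (X.J ∩ container X.G w₂) := by
              ext u; simp only [mem_inter]; tauto
            rw [e, add_comm (#(_ ∩ _ ∩ _)), ← card_union_add_card_inter]
            gcongr
            exact union_subset inter_subset_left inter_subset_left
          have h2 : (#(X.J ∩ container X.G w') : ℝ) + #(X.J ∩ container X.G w₂) ≤
              #(X.J ∩ (container X.G w' ∩ container X.G w₂)) + #X.J := by exact_mod_cast h1
          have h4 := X.card_J_le
          have h5 : 0 ≤ X.scale i * X.s := by positivity
          linarith
      have hEm := hE (i + X.α) le_rfl
      set B := {u ∈ container X.G w | degInto X.G (container X.G w) u ≤ D (i + X.α)} ∩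
            container X.G w₂ with hB
      have hBB : (adjPairs X.G B B : ℝ) ≤ X.ε * (Fintype.card V : ℝ) ^ 2 := by
        refine le_trans ?_ hsp
        exact_mod_cast adjPairs_mono inter_subset_right inter_subset_right
      -- A subset of a sparse container cannot reach density `ρ` in a far graph.
      have hBcard : (#B : ℝ) ≤ X.ρ * Fintype.card V := by
        by_contra hcon
        push Not at hcon
        have := X.far B hcon.le
        have : 0 < X.ε * (Fintype.card V : ℝ) ^ 2 := by positivity
        linarith
      refine h.not_subset hi hg inter_subset_left hBcard ?_ hBB ?_
      · have h1 : X.scale (i + X.α + 1) ≤ X.scale i := X.scale_anti (by omega)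
        unfold dens at hEm
        rw [lt_div_iff₀ hN] at hEm
        refine le_trans ?_ hEm.le
        gcongr
        linarith
      · intro k hk
        have h1 := hE k hk.le
        unfold dens at h1
        rw [lt_div_iff₀ hN] at h1
        have h2 : ({u ∈ container X.G w | degInto X.G (container X.G w) u ≤ D k} ∩
            container X.G w₂ : Finset V) ⊆ {u ∈ B | ¬ D k < degInto X.G (container X.G w) u} := by
          intro u hu
          have := h.mono k hk.le
          simp only [hB, mem_inter, mem_filter] at hu ⊢
          exact ⟨⟨⟨hu.1.1, hu.1.2.trans this⟩, hu.2⟩, not_lt.2 hu.1.2⟩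
        have h4 := card_le_card h2
        have h5 := card_filter_add_card_filter_not (s := B)
          (fun u => D k < degInto X.G (container X.G w) u)
        have h6 : (#{u ∈ B | D k < degInto X.G (container X.G w) u} : ℝ) +
            #({u ∈ container X.G w | degInto X.G (container X.G w) u ≤ D k} ∩
              container X.G w₂) ≤ #B := by
          exact_mod_cast (by omega : #{u ∈ B | D k < degInto X.G (container X.G w) u} +
            #({u ∈ container X.G w | degInto X.G (container X.G w) u ≤ D k} ∩
              container X.G w₂) ≤ #B)
        linarith

lemma hasSparseContainer {i : ℕ} (h3 : 3 ≤ i) (hi : i ≤ X.I) : X.HasSparseContainer i := by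
  induction i, h3 using Nat.le_induction with
  | base => exact hasSparseContainer_of_pred le_rfl hi (Or.inl rfl)
  | succ i h3 ih => exact hasSparseContainer_of_pred (by omega) hi (Or.inr (ih (by omega)))

/-- At the last scale the sparse container has density between `ρ - scale I` and `ρ`. Filling it up
arbitrarily to `⌈ρ n⌉` vertices adds at most `(1/2 + 1/16) ε n²` ordered pairs to the `ε n²`
present, fewer than the `2 ε n²` required by `far`. -/
lemma false_of_sparseSetting (X : SparseSetting V) : False := by
  obtain ⟨w, hJ, hlen, hloss, hsp⟩ := hasSparseContainer X.three_le_I le_rfl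
  have hN := X.N_pos
  have hκ := X.scale_pos X.I
  have hρ := X.ρ_pos
  have hs := X.s_pos
  have hε := X.ε_pos
  have hκN : 4 ≤ X.scale X.I * Fintype.card V := X.card_V
  have hdens := X.dens_gt_of_noContainer (w₁ := w) (w₂ := []) hJ (by simp) le_rfl
    (by simp only [List.length_nil, Nat.cast_zero, add_zero]; linarith)
    (by rw [container_nil, inter_univ]; nlinarith)
  rw [container_nil, inter_univ] at hdens
  set C := container X.G w
  set N : ℝ := (Fintype.card V : ℝ) with hNdef
  unfold dens at hdens
  rw [lt_div_iff₀ hN] at hdens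
  have hN2 : 0 < X.ε * N ^ 2 := by positivity
  have hCcard : (#C : ℝ) ≤ X.ρ * N := by
    by_contra hcon
    push Not at hcon
    linarith [X.far C hcon.le]
  set n₁ := ⌈X.ρ * N⌉₊ with hn₁
  have hn1 : (n₁ : ℝ) < X.ρ * N + 1 := Nat.ceil_lt_add_one (by positivity)
  have hn1' : X.ρ * N ≤ n₁ := Nat.le_ceil _
  have hCn : #C ≤ n₁ := by
    have : (#C : ℝ) ≤ n₁ := hCcard.trans hn1'
    exact_mod_cast this
  obtain ⟨B, hCB, -, hBcard⟩ := exists_subsuperset_card_eq (subset_univ C) hCn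
    (by rw [card_univ]; exact le_ceil_mul_card_V (X := X))
  have hW : (#(B \ C) : ℝ) ≤ 2 * X.scale X.I * N := by
    rw [card_sdiff_of_subset hCB, hBcard, Nat.cast_sub hCn]
    linarith
  have hfar := X.far B (by rw [hBcard]; exact hn1')
  rw [← union_sdiff_of_subset hCB, adjPairs_union_self disjoint_sdiff] at hfar
  push_cast at hfar
  have h1 : (adjPairs X.G (B \ C) C : ℝ) ≤ #(B \ C) * #C := by exact_mod_cast adjPairs_le_mul _ _
  have h2 : (adjPairs X.G (B \ C) (B \ C) : ℝ) ≤ #(B \ C) * #(B \ C) := by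
    exact_mod_cast adjPairs_le_mul _ _
  have h3 : (adjPairs X.G (B \ C) C : ℝ) ≤ 2 * X.scale X.I * N * (X.ρ * N) :=
    h1.trans (by gcongr)
  have h4 : (adjPairs X.G (B \ C) (B \ C) : ℝ) ≤ 2 * X.scale X.I * N * (2 * X.scale X.I * N) :=
    h2.trans (by gcongr)
  have h5 : X.scale X.I * X.ρ ≤ X.ε / 8 := by
    have := X.le_two_pow_I
    unfold scale
    rw [div_mul_eq_mul_div, div_le_iff₀ (by positivity)]
    nlinarith
  have h6 : X.scale X.I ≤ X.ρ / 8 := by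
    have := X.scale_anti X.three_le_I
    have e : X.scale 3 = X.ρ / 8 := by unfold scale; ring
    linarith
  have h7 : X.scale X.I * X.scale X.I ≤ X.ε / 64 := by nlinarith
  have h8 : X.scale X.I * X.ρ * N ^ 2 ≤ X.ε / 8 * N ^ 2 := by gcongr
  have h9 : X.scale X.I * X.scale X.I * N ^ 2 ≤ X.ε / 64 * N ^ 2 := by gcongr
  nlinarith

end SparseSetting

/-! ### Chernoff and union bounds over words -/

section sampleIntersection

variable {V : Type*} [Fintype V] [DecidableEq V]

/-- Moment generating function of the number of sampled elements of `C`, restricted to the event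
that the sample contains `F`. -/
lemma sum_filter_subset_pow_le {s : ℕ} (hs : s ≤ Fintype.card V) (F C : Finset V) {θ : ℝ}
    (hθ : 0 ≤ θ) :
    ∑ S ∈ (univ : Finset V).powersetCard s with F ⊆ S, (1 + θ) ^ #(S ∩ C) ≤
      ((s : ℝ) / Fintype.card V) ^ #F * (1 + θ) ^ #F *
        Real.exp (θ * ((s : ℝ) / Fintype.card V * #C)) * (Fintype.card V).choose s := by
  set p : ℝ := (s : ℝ) / Fintype.card V with hp
  have hp0 : 0 ≤ p := by positivity
  -- Expanding the power over subsets `B` of `S ∩ (C \ F)` reduces the moment to the probabilities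
  -- that `S` contains `F ∪ B`, so no independence of the sampled vertices is needed.
  have h1 : ∀ S : Finset V, (1 + θ) ^ #(S ∩ C) ≤
      (1 + θ) ^ #F * ∑ B ∈ (C \ F).powerset, if B ⊆ S then θ ^ #B else 0 := by
    intro S
    have e1 : (∑ B ∈ (C \ F).powerset, if B ⊆ S then θ ^ #B else 0) = (1 + θ) ^ #(S ∩ (C \ F)) := by
      rw [← sum_filter, add_comm 1 θ, ← sum_pow_mul_eq_add_pow]
      simp only [one_pow, mul_one]
      refine sum_congr ?_ fun _ _ => rfl
      ext B
      simp only [mem_filter, mem_powerset, subset_inter_iff]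
      tauto
    rw [e1, ← pow_add]
    refine pow_le_pow_right₀ (by linarith) ?_
    refine (card_le_card (t := F ∪ S ∩ (C \ F)) fun u hu => ?_).trans (card_union_le _ _)
    simp only [mem_inter, mem_union, mem_sdiff] at *
    tauto
  calc ∑ S ∈ (univ : Finset V).powersetCard s with F ⊆ S, (1 + θ) ^ #(S ∩ C)
      ≤ ∑ S ∈ (univ : Finset V).powersetCard s with F ⊆ S,
          (1 + θ) ^ #F * ∑ B ∈ (C \ F).powerset, if B ⊆ S then θ ^ #B else 0 :=
        sum_le_sum fun S _ => h1 S
    _ = (1 + θ) ^ #F * ∑ B ∈ (C \ F).powerset,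
          θ ^ #B * #{S ∈ (univ : Finset V).powersetCard s | F ∪ B ⊆ S} := by
        rw [← mul_sum, sum_comm]
        congr 1
        refine sum_congr rfl fun B _ => ?_
        rw [← sum_filter, sum_const, nsmul_eq_mul, mul_comm, filter_filter]
        simp only [union_subset_iff]
    _ ≤ (1 + θ) ^ #F * ∑ B ∈ (C \ F).powerset,
          θ ^ #B * (p ^ (#F + #B) * (Fintype.card V).choose s) := by
        gcongr with B hB
        have hd : Disjoint F B :=
          disjoint_sdiff.mono_right (mem_powerset.1 hB)
        have := card_filter_subset_le (B := univ) (T := F ∪ B) (w := s) (by rwa [card_univ])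
        rwa [card_union_of_disjoint hd, card_univ] at this
    _ = p ^ #F * (1 + θ) ^ #F * (∑ B ∈ (C \ F).powerset, (θ * p) ^ #B * 1 ^ (#(C \ F) - #B)) *
          (Fintype.card V).choose s := by
        rw [mul_sum, mul_sum, sum_mul]
        refine sum_congr rfl fun B _ => ?_
        rw [pow_add, mul_pow]
        ring
    _ ≤ _ := by
        rw [sum_pow_mul_eq_add_pow]
        gcongr
        calc (θ * p + 1) ^ #(C \ F) ≤ (θ * p + 1) ^ #C :=
              pow_le_pow_right₀ (by nlinarith [mul_nonneg hθ hp0]) (card_le_card sdiff_subset)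
          _ ≤ Real.exp (θ * p) ^ #C := by
              gcongr
              exact Real.add_one_le_exp _
          _ = Real.exp (θ * (p * #C)) := by
              rw [← Real.exp_nat_mul]; congr 1; ring

/-- Chernoff bound: the sample contains `F` and hits a set `C` of density `ρ - δ` in a fraction of
at least `ρ - δ / 2` of its elements. -/
lemma card_filter_subset_inter_le {s : ℕ} (hs : s ≤ Fintype.card V) (hV : 0 < Fintype.card V)
    (F C : Finset V) {ρ δ : ℝ} (hρ : 0 < ρ) (hδ : 0 ≤ δ) (hδC : δ = ρ - #C / Fintype.card V) :
    (#{S ∈ (univ : Finset V).powersetCard s | F ⊆ S ∧ ρ * s - δ * s / 2 ≤ #(S ∩ C)} : ℝ) ≤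
      ((s : ℝ) / Fintype.card V) ^ #F * 2 ^ #F * Real.exp (-(δ ^ 2 * s / (8 * ρ))) *
        (Fintype.card V).choose s := by
  have hN : (0 : ℝ) < Fintype.card V := by exact_mod_cast hV
  have hδρ : δ ≤ ρ := by
    rw [hδC]; have : (0 : ℝ) ≤ #C / Fintype.card V := by positivity
    linarith
  -- With `δ = 2 ρ θ` the exponent becomes `-(θ ^ 2 + θ ^ 3) ρ s / 2`.
  obtain ⟨θ, hθ⟩ : ∃ θ, θ = δ / (2 * ρ) := ⟨_, rfl⟩
  have hθ0 : 0 ≤ θ := by rw [hθ]; positivity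
  have hθ1 : θ ≤ 1 := by rw [hθ, div_le_one (by positivity)]; linarith
  have hδθ : δ = 2 * ρ * θ := by rw [hθ]; field_simp
  clear hθ
  set a := ρ * s - δ * s / 2 with ha
  have hs0 : (0 : ℝ) ≤ s := by positivity
  have hlog : θ - θ ^ 2 / 2 ≤ Real.log (1 + θ) := by
    refine le_trans ?_ (Real.le_log_one_add_of_nonneg hθ0)
    rw [le_div_iff₀ (by linarith)]
    nlinarith [pow_nonneg hθ0 3]
  have h1 := sum_filter_subset_pow_le hs F C hθ0
  have h2 : (#{S ∈ (univ : Finset V).powersetCard s | F ⊆ S ∧ a ≤ #(S ∩ C)} : ℝ) *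
      Real.exp ((θ - θ ^ 2 / 2) * a) ≤
      ∑ S ∈ (univ : Finset V).powersetCard s with F ⊆ S, (1 + θ) ^ #(S ∩ C) := by
    rw [← filter_filter, ← nsmul_eq_mul, ← sum_const]
    refine le_trans (sum_le_sum fun S hS => ?_)
      (sum_le_sum_of_subset_of_nonneg (filter_subset _ _) fun _ _ _ => by positivity)
    rw [mem_filter] at hS
    rw [← Real.exp_log (show (0 : ℝ) < 1 + θ by linarith), ← Real.exp_nat_mul]
    refine Real.exp_le_exp.2 ?_
    have h3 : 0 ≤ θ - θ ^ 2 / 2 := by nlinarith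
    calc (θ - θ ^ 2 / 2) * a ≤ (θ - θ ^ 2 / 2) * #(S ∩ C) := by
          gcongr
          exact hS.2
      _ ≤ Real.log (1 + θ) * #(S ∩ C) := by gcongr
      _ = _ := mul_comm _ _
  have h3 : (#{S ∈ (univ : Finset V).powersetCard s | F ⊆ S ∧ a ≤ #(S ∩ C)} : ℝ) ≤
      ((s : ℝ) / Fintype.card V) ^ #F * (1 + θ) ^ #F *
        Real.exp (θ * ((s : ℝ) / Fintype.card V * #C)) * (Fintype.card V).choose s *
        Real.exp (-((θ - θ ^ 2 / 2) * a)) := by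
    rw [Real.exp_neg, ← div_eq_mul_inv, le_div_iff₀ (Real.exp_pos _)]
    exact h2.trans h1
  refine h3.trans ?_
  have h4 : Real.exp (θ * ((s : ℝ) / Fintype.card V * #C)) * Real.exp (-((θ - θ ^ 2 / 2) * a)) ≤
      Real.exp (-(δ ^ 2 * s / (8 * ρ))) := by
    rw [← Real.exp_add]
    refine Real.exp_le_exp.2 ?_
    have h5 : (s : ℝ) / Fintype.card V * #C = s * (ρ - δ) := by rw [hδC]; field_simp; ring
    have h6 : δ ^ 2 * s / (8 * ρ) = ρ * θ ^ 2 * s / 2 := by rw [hδθ]; field_simp; ring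
    rw [h5, h6, ha, hδθ]
    have h7 : 0 ≤ ρ * s * θ ^ 3 := by positivity
    linarith
  calc _ = ((s : ℝ) / Fintype.card V) ^ #F * (1 + θ) ^ #F *
        (Real.exp (θ * ((s : ℝ) / Fintype.card V * #C)) * Real.exp (-((θ - θ ^ 2 / 2) * a))) *
        (Fintype.card V).choose s := by ring
    _ ≤ _ := by
      gcongr
      linarith

end sampleIntersection

section letters

variable {V : Type*} [DecidableEq V]

/-- The vertices occurring in a word. -/
def letters {τ : ℕ} (f : Fin τ → V × Bool) : Finset V := univ.image fun i => (f i).1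

lemma card_letters_le {τ : ℕ} (f : Fin τ → V × Bool) : #(letters f) ≤ τ :=
  card_image_le.trans (by simp)

lemma letters_cons {τ : ℕ} (a : V × Bool) (f : Fin τ → V × Bool) :
    letters (Fin.cons a f : Fin (τ + 1) → V × Bool) = insert a.1 (letters f) := by
  ext v
  simp [letters, Fin.exists_fin_succ, eq_comm]

end letters

section denseContainers

variable {V : Type*} [Fintype V] [DecidableEq V]

/-- A further letter either uses a fresh vertex, at weight `p`, or repeats one of at most `T`
earlier vertices, at weight `1`; the factor `2` counts the Boolean. -/
lemma sum_pow_card_letters_le (T : ℕ) {p : ℝ} (hp : 0 ≤ p) {τ : ℕ} (hτ : τ ≤ T) :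
    ∑ f : Fin τ → V × Bool, p ^ #(letters f) ≤ (2 * (p * Fintype.card V + T)) ^ τ := by
  induction τ with
  | zero => simp [letters]
  | succ τ ih =>
    have ih := ih (by omega)
    rw [← (Fin.consEquiv (fun _ : Fin (τ + 1) => V × Bool)).sum_comp, Fintype.sum_prod_type,
      sum_comm]
    have h1 : ∀ f : Fin τ → V × Bool, ∑ a : V × Bool,
        p ^ #(letters (Fin.cons a f : Fin (τ + 1) → V × Bool)) ≤
        p ^ #(letters f) * (2 * (p * Fintype.card V + T)) := by
      intro f
      have h2 : ∀ a : V × Bool, p ^ #(letters (Fin.cons a f : Fin (τ + 1) → V × Bool)) ≤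
          p ^ #(letters f) * (p + if a.1 ∈ letters f then 1 else 0) := by
        intro a
        rw [letters_cons]
        split_ifs with ha
        · rw [insert_eq_of_mem ha]
          nlinarith [pow_nonneg hp #(letters f), mul_nonneg (pow_nonneg hp #(letters f)) hp]
        · rw [card_insert_of_notMem ha, pow_succ, add_zero]
      refine (sum_le_sum fun a _ => h2 a).trans ?_
      rw [← mul_sum]
      gcongr
      rw [sum_add_distrib, sum_const, card_univ, nsmul_eq_mul, Fintype.sum_prod_type]
      have h4 : ∑ v : V, ∑ _b : Bool, (if v ∈ letters f then (1 : ℝ) else 0) = 2 * #(letters f) := by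
        rw [sum_comm]
        simp
      rw [h4, Fintype.card_prod, Fintype.card_bool]
      have h3 : (#(letters f) : ℝ) ≤ T := by
        have := card_letters_le f
        exact_mod_cast (by omega : #(letters f) ≤ T)
      push_cast
      linarith
    refine (sum_le_sum fun f _ => h1 f).trans ?_
    rw [← sum_mul, pow_succ]
    gcongr

/-- The sample `S` contains the words of a container that is small although it contains a large
part of the sample. -/
def HasDenseContainer (G : SimpleGraph V) (ρ b₁ b₂ : ℝ) (S : Finset V) : Prop :=
  ∃ w₁ w₂ : List (V × Bool), (∀ a ∈ w₁, a.1 ∈ S) ∧ (∀ a ∈ w₂, a.1 ∈ S) ∧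
    b₁ ≤ ρ - #(container G w₁ ∩ container G w₂) / Fintype.card V ∧
    b₂ * (w₁.length + w₂.length) ≤ ρ - #(container G w₁ ∩ container G w₂) / Fintype.card V ∧
    ρ * #S - #(S ∩ (container G w₁ ∩ container G w₂)) ≤
      (ρ - #(container G w₁ ∩ container G w₂) / Fintype.card V) * #S / 2

-- Union bound over the words of length `τ ≤ s` and their splittings into two. Weighting a word by
-- the probability that its letters are sampled keeps the sum free of `n`.
open Classical in
lemma card_filter_hasDenseContainer_le (G : SimpleGraph V) {ρ b₁ b₂ : ℝ} {s : ℕ}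
    (hs : s ≤ Fintype.card V) (hs0 : 0 < s) (hρ : 0 < ρ) (hb₁ : 0 < b₁) (hb₂ : 0 < b₂)
    (hρs : ρ ≤ b₂ * s) (h1 : 64 * ρ ≤ b₁ ^ 2 * s)
    (h2 : Real.log (32 * s) ≤ b₁ * b₂ * s / (16 * ρ)) :
    (#{S ∈ (univ : Finset V).powersetCard s | HasDenseContainer G ρ b₁ b₂ S} : ℝ) ≤
      1 / 16 * (Fintype.card V).choose s := by
  have hV : 0 < Fintype.card V := hs0.trans_le hs
  have hN : (0 : ℝ) < Fintype.card V := by exact_mod_cast hV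
  have hsR : (0 : ℝ) < s := by exact_mod_cast hs0
  -- A pair of words is encoded as their concatenation together with the splitting position `i`.
  let cont : (τ : ℕ) → (Fin τ → V × Bool) → ℕ → Finset V := fun τ f i =>
    container G ((List.ofFn f).take i) ∩ container G ((List.ofFn f).drop i)
  let gap : (τ : ℕ) → (Fin τ → V × Bool) → ℕ → ℝ := fun τ f i =>
    ρ - #(cont τ f i) / Fintype.card V
  let E : (τ : ℕ) → (Fin τ → V × Bool) → ℕ → Finset (Finset V) := fun τ f i =>
    if b₁ ≤ gap τ f i ∧ b₂ * τ ≤ gap τ f i then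
      {S ∈ (univ : Finset V).powersetCard s | letters f ⊆ S ∧
        ρ * s - gap τ f i * s / 2 ≤ #(S ∩ cont τ f i)}
    else ∅
  set N : ℝ := (Fintype.card V : ℝ) with hNdef
  set M : ℝ := ((Fintype.card V).choose s : ℝ) with hM
  have hsub : ({S ∈ (univ : Finset V).powersetCard s | HasDenseContainer G ρ b₁ b₂ S}) ⊆
      (range (s + 1)).biUnion fun τ => univ.biUnion fun f => (range (τ + 1)).biUnion (E τ f) := by
    intro S hS
    rw [mem_filter] at hS
    obtain ⟨hScard, w₁, w₂, hw₁, hw₂, h3, h4, h5⟩ := hS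
    rw [mem_powersetCard_univ.1 hScard] at h5
    set w := w₁ ++ w₂ with hw
    have htake : (List.ofFn w.get).take w₁.length = w₁ := by rw [List.ofFn_get, hw]; simp
    have hdrop : (List.ofFn w.get).drop w₁.length = w₂ := by rw [List.ofFn_get, hw]; simp
    have hcont : cont w.length w.get w₁.length = container G w₁ ∩ container G w₂ := by
      simp only [cont, htake, hdrop]
    have hlen : (w.length : ℝ) = w₁.length + w₂.length := by rw [hw]; simp
    have hwS : ∀ a ∈ w, a.1 ∈ S := by
      intro a ha
      rw [hw, List.mem_append] at ha
      rcases ha with ha | ha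
      exacts [hw₁ a ha, hw₂ a ha]
    have hwlen : w.length ≤ s := by
      have h6 : b₂ * w.length ≤ b₂ * s := by
        rw [hlen]
        refine h4.trans (le_trans ?_ hρs)
        have : (0 : ℝ) ≤ #(container G w₁ ∩ container G w₂) / N := by positivity
        linarith
      exact_mod_cast le_of_mul_le_mul_left h6 hb₂
    simp only [mem_biUnion, mem_range, mem_univ, true_and]
    refine ⟨w.length, by omega, w.get, w₁.length, ?_, ?_⟩
    · have : w.length = w₁.length + w₂.length := by rw [hw]; simp
      omega
    · have hgap : gap w.length w.get w₁.length =
          ρ - #(container G w₁ ∩ container G w₂) / N := by simp only [gap, hcont]; rfl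
      simp only [E]
      rw [hgap, hlen, if_pos ⟨h3, h4⟩, mem_filter, hcont]
      refine ⟨hScard, ?_, by linarith⟩
      intro v hv
      simp only [letters, mem_image, mem_univ, true_and] at hv
      obtain ⟨j, rfl⟩ := hv
      exact hwS _ (List.get_mem _ _)
  have hE : ∀ τ (f : Fin τ → V × Bool) i, (#(E τ f i) : ℝ) ≤
      ((s : ℝ) / N) ^ #(letters f) * (2 ^ τ * (Real.exp (-4) * (1 / (32 * s)) ^ τ) * M) := by
    intro τ f i
    simp only [E]
    split_ifs with hc
    · have hg0 : 0 ≤ gap τ f i := hb₁.le.trans hc.1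
      refine (card_filter_subset_inter_le hs hV (letters f) (cont τ f i) hρ hg0 rfl).trans ?_
      have h3 : Real.exp (-(gap τ f i ^ 2 * s / (8 * ρ))) ≤
          Real.exp (-4) * (1 / (32 * s)) ^ τ := by
        have h4 : (1 / (32 * s) : ℝ) ^ τ = Real.exp (-(τ * Real.log (32 * s))) := by
          rw [Real.exp_neg, Real.exp_nat_mul, Real.exp_log (by positivity), one_div, inv_pow]
        rw [h4, ← Real.exp_add]
        refine Real.exp_le_exp.2 ?_
        -- The squared gap dominates both terms: the first yields the constant `exp (-4)`, the
        -- second a factor `1 / (32 s)` per letter.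
        have h5 : b₁ ^ 2 + b₁ * b₂ * τ ≤ 2 * gap τ f i ^ 2 := by
          have h6 : b₁ ^ 2 ≤ gap τ f i ^ 2 := by gcongr; exact hc.1
          have h7 : b₁ * (b₂ * τ) ≤ gap τ f i * gap τ f i := by
            gcongr
            exacts [hc.1, hc.2]
          nlinarith
        have h6 : (b₁ ^ 2 + b₁ * b₂ * τ) * s / (16 * ρ) ≤ gap τ f i ^ 2 * s / (8 * ρ) := by
          rw [div_le_div_iff₀ (by positivity) (by positivity)]
          have := mul_le_mul_of_nonneg_right h5 (show 0 ≤ s * (8 * ρ) by positivity)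
          linarith
        have h7 : (b₁ ^ 2 + b₁ * b₂ * τ) * s / (16 * ρ) =
            b₁ ^ 2 * s / (16 * ρ) + τ * (b₁ * b₂ * s / (16 * ρ)) := by field_simp
        have h8 : 4 ≤ b₁ ^ 2 * s / (16 * ρ) := by
          rw [le_div_iff₀ (by positivity)]; linarith
        have h9 : τ * Real.log (32 * s) ≤ τ * (b₁ * b₂ * s / (16 * ρ)) := by gcongr
        linarith
      have h4 : (2 : ℝ) ^ #(letters f) ≤ 2 ^ τ :=
        pow_le_pow_right₀ (by norm_num) (card_letters_le f)
      calc _ ≤ ((s : ℝ) / N) ^ #(letters f) * 2 ^ τ *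
            (Real.exp (-4) * (1 / (32 * s)) ^ τ) * M := by gcongr
        _ = _ := by ring
    · simp only [card_empty, Nat.cast_zero]
      positivity
  have hexp : Real.exp (-4) ≤ 1 / 32 := by
    rw [Real.exp_neg, ← one_div]
    have h3 := Real.exp_one_gt_d9
    have h4 : Real.exp 4 = Real.exp 1 ^ 4 := by rw [← Real.exp_nat_mul]; norm_num
    have h5 : (32 : ℝ) ≤ Real.exp 4 := by
      rw [h4]
      calc (32 : ℝ) ≤ 2.7 ^ 4 := by norm_num
        _ ≤ _ := by gcongr; linarith
    gcongr
  have hsum : ∀ τ ≤ s, (#(univ.biUnion fun f : Fin τ → V × Bool =>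
      (range (τ + 1)).biUnion (E τ f)) : ℝ) ≤ (1 / 2) ^ τ * (1 / 32 * M) := by
    intro τ hτ
    have h3 : (#(univ.biUnion fun f : Fin τ → V × Bool =>
        (range (τ + 1)).biUnion (E τ f)) : ℝ) ≤
        ∑ f : Fin τ → V × Bool, ∑ i ∈ range (τ + 1), (#(E τ f i) : ℝ) := by
      exact_mod_cast card_biUnion_le.trans (sum_le_sum fun f _ => card_biUnion_le)
    refine h3.trans ?_
    have h4 : ∑ f : Fin τ → V × Bool, ∑ i ∈ range (τ + 1), (#(E τ f i) : ℝ) ≤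
        ∑ f : Fin τ → V × Bool, ∑ i ∈ range (τ + 1), ((s : ℝ) / N) ^ #(letters f) *
          (2 ^ τ * (Real.exp (-4) * (1 / (32 * s)) ^ τ) * M) :=
      sum_le_sum fun f _ => sum_le_sum fun i _ => hE τ f i
    refine h4.trans ?_
    simp only [sum_const, card_range, nsmul_eq_mul]
    rw [← mul_sum, ← sum_mul]
    have h5 := sum_pow_card_letters_le (V := V) s (p := (s : ℝ) / N) (by positivity) hτ
    have h6 : (s : ℝ) / N * (Fintype.card V : ℕ) = s := div_mul_cancel₀ _ hN.ne'
    rw [h6] at h5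
    have h7 : ((τ + 1 : ℕ) : ℝ) ≤ 2 ^ τ := by exact_mod_cast Nat.lt_two_pow_self (n := τ)
    -- Per letter: `4 s` from the words, `2` from the splittings, `2` from the Chernoff bound and `1
    -- / (32 s)` from its exponent, in all `1/2`.
    calc _ ≤ (2 : ℝ) ^ τ * ((2 * ((s : ℝ) + s)) ^ τ *
          (2 ^ τ * (1 / 32 * (1 / (32 * s)) ^ τ) * M)) := by gcongr
      _ = (2 * (2 * ((s : ℝ) + s)) * 2 * (1 / (32 * s))) ^ τ * (1 / 32 * M) := by
        generalize 2 * ((s : ℝ) + s) = x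
        generalize (1 : ℝ) / (32 * s) = y
        rw [mul_pow, mul_pow, mul_pow]; ring
      _ = _ := by
        congr 2
        field_simp
        ring
  calc _ ≤ (#((range (s + 1)).biUnion fun τ => univ.biUnion fun f =>
        (range (τ + 1)).biUnion (E τ f)) : ℝ) := by exact_mod_cast card_le_card hsub
    _ ≤ ∑ τ ∈ range (s + 1), (#(univ.biUnion fun f : Fin τ → V × Bool =>
        (range (τ + 1)).biUnion (E τ f)) : ℝ) := by exact_mod_cast card_biUnion_le
    _ ≤ ∑ τ ∈ range (s + 1), (1 / 2 : ℝ) ^ τ * (1 / 32 * M) :=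
        sum_le_sum fun τ hτ => hsum τ (by rw [mem_range] at hτ; omega)
    _ ≤ 2 * (1 / 32 * M) := by
        rw [← sum_mul]
        gcongr
        exact sum_geometric_two_le _
    _ = _ := by ring

end denseContainers

/-! ### Log-concave tails at the mean -/

/-- Bernoulli with exponent `M / 2` gives `1/2`; then square. -/
lemma quarter_le_one_sub_inv_pow {M : ℕ} (hM : 2 ≤ M) : (1 / 4 : ℝ) ≤ (1 - 1 / M) ^ M := by
  have hM' : (2 : ℝ) ≤ M := by exact_mod_cast hM
  have h0 : (0 : ℝ) ≤ 1 - 1 / M := by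
    rw [sub_nonneg, div_le_one (by linarith)]; linarith
  have h1 := one_add_mul_self_le_rpow_one_add (s := -(1 / (M : ℝ))) (by linarith)
    (p := (M : ℝ) / 2) (by linarith)
  have h2 : 1 + (M : ℝ) / 2 * -(1 / (M : ℝ)) = 1 / 2 := by field_simp; norm_num
  rw [h2, ← sub_eq_add_neg] at h1
  have h3 : ((1 - 1 / (M : ℝ)) ^ ((M : ℝ) / 2)) ^ 2 = (1 - 1 / (M : ℝ)) ^ M := by
    rw [← Real.rpow_mul_natCast h0, ← Real.rpow_natCast (1 - 1 / (M : ℝ)) M]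
    congr 1
    push_cast
    ring
  rw [← h3]
  nlinarith

/-- If a log-concave survival function has mean at least `k`, then its value at `k` is at
least `1 / 4`. -/
lemma quarter_le_of_logConcave_tail {T : ℕ → ℝ} {m k : ℕ} (h0 : T 0 = 1) (hT : Antitone T)
    (hm : ∀ j, m < j → T j = 0) (hlc : ∀ j, T (j + 2) * T j ≤ T (j + 1) ^ 2)
    (hmean : (k : ℝ) ≤ ∑ j ∈ range m, T (j + 1)) : 1 / 4 ≤ T k := by
  by_contra hlt
  push Not at hlt
  have hnn : ∀ j, 0 ≤ T j := fun j => by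
    rw [← hm (max j (m + 1)) (by omega)]
    exact hT (le_max_left _ _)
  have hle1 : ∀ j, T j ≤ 1 := fun j => h0 ▸ hT (Nat.zero_le j)
  have hk0 : k ≠ 0 := by rintro rfl; linarith
  set α := T k with hα
  have hsplit : ∀ l ≤ m, ∑ j ∈ range m, T (j + 1) =
      ∑ j ∈ range l, T (j + 1) + ∑ j ∈ range (m - l), T (l + j + 1) := by
    intro l hl
    conv_lhs => rw [← Nat.add_sub_cancel' hl, sum_range_add]
  have hα0 : 0 < α := by
    by_contra hneg
    have hα0 : T k = 0 := le_antisymm (not_lt.1 hneg) (hnn k)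
    have h1 : ∀ j ∈ range m, T (j + 1) ≤ if j < k - 1 then 1 else 0 := by
      intro j _
      split_ifs with hj
      · exact hle1 _
      · rw [← hα0]
        exact hT (by omega)
    have h2 := hmean.trans (sum_le_sum h1)
    rw [← sum_filter, sum_const, nsmul_eq_mul, mul_one] at h2
    have h3 : #{j ∈ range m | j < k - 1} ≤ k - 1 := by
      refine (card_le_card (t := range (k - 1)) fun j hj => ?_).trans (by simp)
      rw [mem_filter] at hj
      exact mem_range.2 hj.2
    have h4 : k ≤ #{j ∈ range m | j < k - 1} := by exact_mod_cast h2
    omega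
  have hkm : k ≤ m := by
    by_contra hcon
    rw [hα, hm k (by omega)] at hα0
    exact lt_irrefl _ hα0
  set q := T (k + 1) / α with hq
  have hq0 : 0 ≤ q := div_nonneg (hnn _) hα0.le
  -- Log-concavity makes the ratios of consecutive tails non-increasing. Hence `T` lies below the
  -- geometric sequence through `T k` with ratio `q`, on both sides of `k`.
  have hup : ∀ i, T (k + i + 1) ≤ q * T (k + i) := by
    intro i
    induction i with
    | zero => rw [add_zero, ← hα, hq, div_mul_cancel₀ _ hα0.ne']
    | succ i ih =>
      rcases (hnn (k + i)).eq_or_lt with h | h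
      · have h1 : T (k + (i + 1) + 1) = 0 :=
          le_antisymm (h ▸ hT (by omega)) (hnn _)
        rw [h1]
        exact mul_nonneg hq0 (hnn _)
      · have h1 := hlc (k + i)
        have h2 : T (k + i + 2) * T (k + i) ≤ q * T (k + i + 1) * T (k + i) := by
          nlinarith [hnn (k + i + 1)]
        exact le_of_mul_le_mul_right h2 h
  have hup' : ∀ i, T (k + i) ≤ α * q ^ i := by
    intro i
    induction i with
    | zero => simp [hα]
    | succ i ih =>
      calc T (k + i + 1) ≤ q * T (k + i) := hup i
        _ ≤ q * (α * q ^ i) := by gcongr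
        _ = _ := by ring
  have hdown : ∀ i ≤ k, q * T (k - i) ≤ T (k - i + 1) := by
    intro i
    induction i with
    | zero => intro _; rw [Nat.sub_zero, ← hα, hq, div_mul_cancel₀ _ hα0.ne']
    | succ i ih =>
      intro hi
      have h1 := ih (by omega)
      have e : k - i = k - (i + 1) + 1 := by omega
      rw [e] at h1
      have h2 := hlc (k - (i + 1))
      have h3 : 0 < T (k - (i + 1) + 1) := hα0.trans_le (hT (by omega))
      have h4 : q * T (k - (i + 1)) * T (k - (i + 1) + 1) ≤
          T (k - (i + 1) + 1) * T (k - (i + 1) + 1) := by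
        nlinarith [hnn (k - (i + 1))]
      exact le_of_mul_le_mul_right h4 h3
  have hdown' : ∀ i ≤ k, q ^ i * T (k - i) ≤ α := by
    intro i
    induction i with
    | zero => intro _; simp [hα]
    | succ i ih =>
      intro hi
      have h1 := hdown (i + 1) hi
      have e : k - (i + 1) + 1 = k - i := by omega
      rw [e] at h1
      calc q ^ (i + 1) * T (k - (i + 1)) = q ^ i * (q * T (k - (i + 1))) := by ring
        _ ≤ q ^ i * T (k - i) := by gcongr
        _ ≤ α := ih (by omega)
  -- At distance `M` or more to the left of `k`, the geometric bound is no better than the trivial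
  -- bound `1`.
  have hex : ∃ M, q ^ M ≤ α := ⟨k, by simpa [h0] using hdown' k le_rfl⟩
  have hM := Nat.find_spec hex
  have hMk : Nat.find hex ≤ k := Nat.find_min' hex (by simpa [h0] using hdown' k le_rfl)
  have hMmin : ∀ i < Nat.find hex, α < q ^ i := fun i hi => not_le.1 (Nat.find_min hex hi)
  set M := Nat.find hex
  have hM0 : M ≠ 0 := by
    intro h
    rw [h, pow_zero] at hM
    linarith
  have hq1 : q < 1 := by
    by_contra hcon
    push Not at hcon
    have := one_le_pow₀ hcon (n := M)
    linarith
  set r := q ^ (M - 1) with hr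
  have hrα : α < r := hMmin _ (by omega)
  have hr0 : 0 < r := hα0.trans hrα
  have hqM : q ^ M = q * r := by
    rw [hr, ← pow_succ']
    congr 1
    omega
  have h1q : 0 < 1 - q := by linarith
  have hgeo : ∀ l : ℕ, (1 - q) * ∑ i ∈ range l, q ^ i = 1 - q ^ l := fun l => by
    rw [mul_comm, geom_sum_mul_neg]
  have hA : ∑ j ∈ range (k - M), T (j + 1) ≤ k - M := by
    refine (sum_le_sum fun j _ => hle1 _).trans ?_
    rw [sum_const, card_range, nsmul_eq_mul, mul_one, Nat.cast_sub hMk]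
  have hB : r * ((1 - q) * ∑ j ∈ range M, T (k - M + j + 1)) ≤ α * (1 - q * r) := by
    have h1 : ∀ j ∈ range M, r * T (k - M + j + 1) ≤ α * q ^ j := by
      intro j hj
      rw [mem_range] at hj
      have h2 := hdown' (M - 1 - j) (by omega)
      have e : k - (M - 1 - j) = k - M + j + 1 := by omega
      rw [e] at h2
      have e2 : r = q ^ (M - 1 - j) * q ^ j := by
        rw [hr, ← pow_add]
        congr 1
        omega
      rw [e2]
      nlinarith [mul_le_mul_of_nonneg_right h2 (pow_nonneg hq0 j)]
    have h3 := sum_le_sum h1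
    rw [← mul_sum, ← mul_sum] at h3
    have h4 := mul_le_mul_of_nonneg_left h3 h1q.le
    have h5 := hgeo M
    rw [hqM] at h5
    calc _ = (1 - q) * (r * ∑ j ∈ range M, T (k - M + j + 1)) := by ring
      _ ≤ _ := h4
      _ = α * ((1 - q) * ∑ i ∈ range M, q ^ i) := by ring
      _ = _ := by rw [h5]
  have hC : (1 - q) * ∑ j ∈ range (m - k), T (k + j + 1) ≤ α * q := by
    have h1 : ∀ j ∈ range (m - k), T (k + j + 1) ≤ α * q * q ^ j := fun j _ =>
      (hup' (j + 1)).trans (le_of_eq (by ring))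
    have h3 := sum_le_sum h1
    rw [← mul_sum] at h3
    have h4 := mul_le_mul_of_nonneg_left h3 h1q.le
    refine h4.trans ?_
    calc _ = α * q * ((1 - q) * ∑ i ∈ range (m - k), q ^ i) := by ring
      _ = α * q * (1 - q ^ (m - k)) := by rw [hgeo]
      _ ≤ α * q * 1 := by
        have := pow_nonneg hq0 (m - k)
        gcongr
        linarith
      _ = _ := mul_one _
  -- The trivial bound covers `k - M` of the mean, so the two geometric pieces must sum to at least
  -- `M`. After scaling by `(1 - q) r`, their bounds add up to exactly `α`.
  have hkey : (M : ℝ) * (1 - q) * r ≤ α := by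
    rw [hsplit k hkm] at hmean
    have h2 : ∑ j ∈ range k, T (j + 1) =
        ∑ j ∈ range (k - M), T (j + 1) + ∑ j ∈ range M, T (k - M + j + 1) := by
      conv_lhs => rw [← Nat.sub_add_cancel hMk, sum_range_add]
    rw [h2] at hmean
    have h3 : (M : ℝ) ≤ ∑ j ∈ range M, T (k - M + j + 1) + ∑ j ∈ range (m - k), T (k + j + 1) := by
      linarith
    have h4 := mul_le_mul_of_nonneg_left h3 h1q.le
    have h5 := mul_le_mul_of_nonneg_left h4 hr0.le
    have h6 := mul_le_mul_of_nonneg_left hC hr0.le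
    nlinarith
  -- Since `α < r`, this gives `q > 1 - 1 / M`, hence `q ^ M ≥ 1/4` for `M ≥ 2`, contradicting `q ^
  -- M ≤ α < 1/4`.
  have hMq : (M : ℝ) * (1 - q) < 1 := by
    by_contra hcon
    push Not at hcon
    nlinarith
  rcases (by omega : M = 1 ∨ 2 ≤ M) with h1 | h2
  · have hr1 : r = 1 := by rw [hr, h1]; simp
    rw [h1] at hM hkey
    rw [hr1] at hkey
    norm_num at hM hkey
    linarith
  · have hM' : (0 : ℝ) < M := by exact_mod_cast (by omega : 0 < M)
    have h3 : 1 - 1 / (M : ℝ) ≤ q := by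
      rw [sub_le_comm, le_div_iff₀ hM']
      linarith
    have h4 : (0 : ℝ) ≤ 1 - 1 / M := by
      rw [sub_nonneg, div_le_one hM']
      exact_mod_cast (by omega : 1 ≤ M)
    have h5 := pow_le_pow_left₀ h4 h3 M
    linarith [quarter_le_one_sub_inv_pow h2]

/-- The tail of a log-concave sequence is log-concave. -/
lemma quarter_le_tail {p : ℕ → ℝ} {m k : ℕ} (hp : ∀ j, 0 ≤ p j)
    (hlc : ∀ i j, j ≤ i → p (i + 1) * p j ≤ p i * p (j + 1))
    (hm : ∀ j, m < j → p j = 0) (htot : 0 < ∑ j ∈ range (m + 1), p j)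
    (hmean : k * ∑ j ∈ range (m + 1), p j ≤ ∑ j ∈ range (m + 1), j * p j) :
    (∑ j ∈ range (m + 1), p j) / 4 ≤ ∑ j ∈ range (m + 1) with k ≤ j, p j := by
  set P := ∑ j ∈ range (m + 1), p j with hP
  set T : ℕ → ℝ := fun l => ∑ j ∈ range (m + 1) with l ≤ j, p j with hT
  have hsucc : ∀ l, T l = p l + T (l + 1) := by
    intro l
    by_cases hl : l ≤ m
    · have : ({j ∈ range (m + 1) | l ≤ j} : Finset ℕ) =
          insert l {j ∈ range (m + 1) | l + 1 ≤ j} := by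
        ext j
        simp only [mem_filter, mem_range, mem_insert]
        omega
      simp only [hT]
      rw [this, sum_insert (by simp)]
    · have h1 : ∀ l, m < l → T l = 0 := fun l hl => sum_eq_zero fun j hj => by
        rw [mem_filter, mem_range] at hj
        omega
      rw [h1 l (by omega), h1 (l + 1) (by omega), hm l (by omega), add_zero]
  have hTnn : ∀ l, 0 ≤ T l := fun l => sum_nonneg fun _ _ => hp _
  have hT0 : T 0 = P := by simp [hT, hP]
  have hlcT : ∀ l, T (l + 2) * T l ≤ T (l + 1) ^ 2 := by
    intro l
    have h1 : T (l + 2) * p l ≤ T (l + 1) * p (l + 1) := by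
      have e : T (l + 2) = ∑ j ∈ range (m + 1) with l + 1 ≤ j, p (j + 1) := by
        have h2 : T (l + 2) = ∑ j ∈ range (m + 2) with l + 2 ≤ j, p j := by
          simp only [hT]
          rw [sum_filter, sum_filter, sum_range_succ _ (m + 1), hm (m + 1) (by omega)]
          simp
        rw [h2, sum_filter, sum_filter, sum_range_succ']
        simp
      rw [e]
      simp only [hT]
      rw [sum_mul, sum_mul]
      refine sum_le_sum fun j hj => ?_
      rw [mem_filter] at hj
      exact hlc j l (by omega)
    have e1 := hsucc l
    have e2 := hsucc (l + 1)
    calc T (l + 2) * T l = T (l + 2) * p l + T (l + 2) * T (l + 1) := by rw [e1]; ring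
      _ ≤ T (l + 1) * p (l + 1) + T (l + 2) * T (l + 1) := by gcongr
      _ = T (l + 1) * (p (l + 1) + T (l + 1 + 1)) := by ring
      _ = _ := by rw [← e2, sq]
  have hsum : ∑ j ∈ range m, T (j + 1) = ∑ j ∈ range (m + 1), j * p j := by
    simp only [hT, sum_filter]
    rw [sum_comm]
    refine sum_congr rfl fun j hj => ?_
    rw [← sum_filter, sum_const, nsmul_eq_mul]
    congr 2
    have : ({l ∈ range m | l + 1 ≤ j} : Finset ℕ) = range j := by
      ext l
      simp only [mem_filter, mem_range] at *
      omega
    rw [this, card_range]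
  have := quarter_le_of_logConcave_tail (T := fun l => T l / P) (m := m) (k := k)
    (by rw [hT0]; exact div_self htot.ne')
    (antitone_nat_of_succ_le fun l => by
      have := hsucc l
      have := hp l
      gcongr
      linarith)
    (fun j hj => by
      have : T j = 0 := sum_eq_zero fun i hi => by
        rw [mem_filter, mem_range] at hi
        omega
      rw [this, zero_div])
    (fun l => by
      rw [div_mul_div_comm, div_pow, ← sq]
      gcongr
      exact hlcT l)
    (by rw [← sum_div, le_div_iff₀ htot, hsum]; exact hmean)
  rw [le_div_iff₀ htot] at this
  linarith

lemma choose_succ_mul_choose_le {K a b : ℕ} (h : b ≤ a) :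
    K.choose (a + 1) * K.choose b ≤ K.choose a * K.choose (b + 1) := by
  rcases Nat.lt_or_ge K (a + 1) with hK | hK
  · rw [Nat.choose_eq_zero_of_lt hK, zero_mul]
    exact Nat.zero_le _
  · have h1 := Nat.choose_succ_right_eq K a
    have h2 := Nat.choose_succ_right_eq K b
    have h3 : (K - a) * (b + 1) ≤ (K - b) * (a + 1) := Nat.mul_le_mul (by omega) (by omega)
    refine Nat.le_of_mul_le_mul_right (c := (a + 1) * (b + 1)) ?_ (by positivity)
    calc K.choose (a + 1) * K.choose b * ((a + 1) * (b + 1))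
        = (K.choose (a + 1) * (a + 1)) * (K.choose b * (b + 1)) := by ring
      _ = K.choose a * K.choose b * ((K - a) * (b + 1)) := by rw [h1]; ring
      _ ≤ K.choose a * K.choose b * ((K - b) * (a + 1)) := by gcongr
      _ = K.choose a * (a + 1) * (K.choose b * (K - b)) := by ring
      _ = _ := by rw [← h2]; ring

/-! ### The hypergeometric distribution -/

section hypergeometric

variable {V : Type*} [Fintype V] [DecidableEq V]

lemma card_filter_inter_eq {I A : Finset V} (hA : A ⊆ I) {s : ℕ} (hs : #A ≤ s) :
    #{S ∈ (univ : Finset V).powersetCard s | S ∩ I = A} =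
      (Fintype.card V - #I).choose (s - #A) := by
  rw [← card_compl, ← card_powersetCard]
  refine card_nbij' (fun S => S \ I) (fun B => A ∪ B) ?_ ?_ ?_ ?_
  · intro S hS
    simp only [coe_filter, Set.mem_ofPred_eq, mem_powersetCard, subset_univ, true_and] at hS
    simp only [mem_coe, mem_powersetCard]
    refine ⟨fun u hu => mem_compl.2 (mem_sdiff.1 hu).2, ?_⟩
    have := card_sdiff_add_card_inter S I
    rw [hS.2] at this
    omega
  · intro B hB
    simp only [mem_coe, mem_powersetCard] at hB
    have hd : Disjoint I B := disjoint_compl_right.mono_right hB.1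
    simp only [coe_filter, Set.mem_ofPred_eq, mem_powersetCard, subset_univ, true_and]
    refine ⟨?_, ?_⟩
    · rw [card_union_of_disjoint (hd.mono_left hA), hB.2]
      omega
    · rw [union_inter_distrib_right, inter_eq_left.2 hA, (disjoint_iff_inter_eq_empty.1 hd.symm),
        union_empty]
  · intro S hS
    simp only [coe_filter, Set.mem_ofPred_eq] at hS
    simp only
    rw [← hS.2, inter_comm, union_comm, inter_comm, sdiff_union_inter]
  · intro B hB
    simp only [mem_coe, mem_powersetCard] at hB
    have hd : Disjoint I B := disjoint_compl_right.mono_right hB.1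
    simp only
    rw [union_sdiff_distrib, sdiff_eq_empty_iff_subset.2 hA, empty_union,
      sdiff_eq_self_of_disjoint hd.symm]

open Classical in
/-- The trace on `I` of a random sample is, given its size, a uniformly random subset of `I`. -/
lemma card_filter_inter_and {I : Finset V} {s j : ℕ} (hj : j ≤ s) (Q : Finset V → Prop) :
    #{S ∈ (univ : Finset V).powersetCard s | #(S ∩ I) = j ∧ Q (S ∩ I)} =
      #{A ∈ I.powersetCard j | Q A} * (Fintype.card V - #I).choose (s - j) := by
  rw [card_eq_sum_card_fiberwise (f := fun S => S ∩ I) (t := {A ∈ I.powersetCard j | Q A})]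
  · rw [sum_const_nat]
    intro A hA
    rw [mem_filter, mem_powersetCard] at hA
    rw [← hA.1.2, ← card_filter_inter_eq hA.1.1 (by omega), filter_filter]
    congr 1
    refine filter_congr fun S _ => ?_
    constructor
    · exact fun h => h.2
    · rintro rfl
      exact ⟨⟨rfl, hA.2⟩, rfl⟩
  · intro S hS
    simp only [coe_filter, Set.mem_ofPred_eq] at hS
    simp only [coe_filter, Set.mem_ofPred_eq, mem_powersetCard]
    exact ⟨⟨inter_subset_right, hS.2.1⟩, hS.2.2⟩

lemma card_filter_card_inter_eq {I : Finset V} {s j : ℕ} (hj : j ≤ s) :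
    #{S ∈ (univ : Finset V).powersetCard s | #(S ∩ I) = j} =
      (#I).choose j * (Fintype.card V - #I).choose (s - j) := by
  classical
  simpa using card_filter_inter_and (I := I) hj fun _ => True

/-- Double counting: every vertex of `I` is sampled with probability `s / |V|`, so the mean of the
intersection is `|I| s / |V|`. -/
lemma mul_choose_le_sum_card_inter {I : Finset V} {s k : ℕ} (hV : 0 < Fintype.card V)
    (hk : k * Fintype.card V ≤ #I * s) :
    (k : ℝ) * (Fintype.card V).choose s ≤
      ∑ S ∈ (univ : Finset V).powersetCard s, (#(S ∩ I) : ℝ) := by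
  have h2 : ∑ S ∈ (univ : Finset V).powersetCard s, #(S ∩ I) =
      ∑ u ∈ I, #{S ∈ (univ : Finset V).powersetCard s | {u} ⊆ S} := by
    have h3 : ∀ S : Finset V, #(S ∩ I) = ∑ u ∈ I, if {u} ⊆ S then 1 else 0 := by
      intro S
      rw [← card_filter, inter_comm, ← filter_mem_eq_inter]
      congr 1
      exact filter_congr fun u _ => singleton_subset_iff.symm
    rw [sum_congr rfl fun S _ => h3 S, sum_comm]
    exact sum_congr rfl fun u _ => (card_filter _ _).symm
  suffices h : k * (Fintype.card V).choose s ≤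
      ∑ S ∈ (univ : Finset V).powersetCard s, #(S ∩ I) by exact_mod_cast h
  rw [h2]
  rcases Nat.eq_zero_or_pos s with rfl | hs0
  · rw [mul_zero, Nat.le_zero, Nat.mul_eq_zero] at hk
    rw [hk.resolve_right hV.ne', zero_mul]
    exact Nat.zero_le _
  · have h3 : ∀ u ∈ I, #{S ∈ (univ : Finset V).powersetCard s | {u} ⊆ S} =
        (Fintype.card V - 1).choose (s - 1) := by
      intro u _
      rw [card_filter_powersetCard_subset _ _ _ (subset_univ _) (by rw [card_singleton]; exact hs0),
        card_univ, card_singleton]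
    rw [sum_const_nat h3]
    obtain ⟨n, hn⟩ : ∃ n, Fintype.card V = n + 1 := ⟨Fintype.card V - 1, by omega⟩
    obtain ⟨t, rfl⟩ : ∃ t, s = t + 1 := ⟨s - 1, by omega⟩
    rw [hn] at hk ⊢
    have h4 := Nat.add_one_mul_choose_eq n t
    rw [Nat.add_sub_cancel, Nat.add_sub_cancel]
    refine Nat.le_of_mul_le_mul_right (c := n + 1) ?_ (by positivity)
    calc k * (n + 1).choose (t + 1) * (n + 1) = k * (n + 1) * (n + 1).choose (t + 1) := by ring
      _ ≤ #I * (t + 1) * (n + 1).choose (t + 1) := by gcongr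
      _ = #I * ((n + 1).choose (t + 1) * (t + 1)) := by ring
      _ = _ := by rw [← h4]; ring

/-- A hypergeometric random variable is at least `k` with probability at least `1 / 4`, if its
mean is at least `k`. -/
lemma quarter_le_card_filter_le_inter {I : Finset V} {s k : ℕ} (hV : 0 < Fintype.card V)
    (hs : s ≤ Fintype.card V) (hk : k * Fintype.card V ≤ #I * s) :
    ((Fintype.card V).choose s : ℝ) / 4 ≤
      ∑ j ∈ range (s + 1) with k ≤ j,
        (#{S ∈ (univ : Finset V).powersetCard s | #(S ∩ I) = j} : ℝ) := by
  set p : ℕ → ℝ := fun j => #{S ∈ (univ : Finset V).powersetCard s | #(S ∩ I) = j} with hp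
  have hmaps : ∀ S ∈ (univ : Finset V).powersetCard s, #(S ∩ I) ∈ range (s + 1) := by
    intro S hS
    rw [mem_powersetCard_univ] at hS
    rw [mem_range, ← hS]
    exact Nat.lt_succ_of_le (card_le_card inter_subset_left)
  have hz : ∀ j, s < j → p j = 0 := by
    intro j hj
    simp only [hp]
    rw [Nat.cast_eq_zero, card_eq_zero, filter_eq_empty_iff]
    intro S hS h
    have := hmaps S hS
    rw [h, mem_range] at this
    omega
  have htot : ∑ j ∈ range (s + 1), p j = (Fintype.card V).choose s := by
    rw [← card_univ, ← card_powersetCard, card_eq_sum_card_fiberwise hmaps]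
    push_cast
    rfl
  have hC : 0 < (Fintype.card V).choose s := Nat.choose_pos hs
  rw [← htot]
  refine quarter_le_tail (fun j => by positivity) ?_ hz (by rw [htot]; exact_mod_cast hC) ?_
  · intro i j hij
    rcases Nat.lt_or_ge s (i + 1) with hi | hi
    · rw [hz _ hi, zero_mul]
      positivity
    · simp only [hp]
      rw [card_filter_card_inter_eq hi, card_filter_card_inter_eq (by omega : j ≤ s),
        card_filter_card_inter_eq (by omega : i ≤ s),
        card_filter_card_inter_eq (by omega : j + 1 ≤ s)]
      have h1 := choose_succ_mul_choose_le (K := #I) hij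
      have h2 := choose_succ_mul_choose_le (K := Fintype.card V - #I)
        (show s - (i + 1) ≤ s - (j + 1) by omega)
      have e1 : s - (j + 1) + 1 = s - j := by omega
      have e2 : s - (i + 1) + 1 = s - i := by omega
      rw [e1, e2] at h2
      have h3 := Nat.mul_le_mul h1 h2
      norm_cast
      linarith
  · rw [htot]
    have h1 : ∑ j ∈ range (s + 1), (j : ℝ) * p j =
        ∑ S ∈ (univ : Finset V).powersetCard s, (#(S ∩ I) : ℝ) := by
      rw [← sum_fiberwise_of_maps_to hmaps]
      refine sum_congr rfl fun j _ => ?_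
      simp only [hp]
      rw [sum_congr rfl fun S hS => by rw [(mem_filter.1 hS).2], sum_const, nsmul_eq_mul, mul_comm]
    rw [h1]
    exact mul_choose_le_sum_card_inter hV hk

end hypergeometric

/-! ### Sparse subsets in samples of close graphs -/

section closeness

variable {V : Type*} [DecidableEq V]

open Classical in
/-- By Markov's inequality, at least half of the `j`-subsets of `I` span at most twice the average
number of edges. -/
lemma half_choose_le_card_filter (G : SimpleGraph V) (I : Finset V) (j : ℕ) :
    ((#I).choose j : ℝ) / 2 ≤ #{A ∈ I.powersetCard j |
      (adjPairs G A A : ℝ) * (#I : ℝ) ^ 2 ≤ 2 * (j : ℝ) ^ 2 * adjPairs G I I} := by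
  rcases Nat.lt_or_ge (#I) j with hj | hj
  · rw [Nat.choose_eq_zero_of_lt hj]
    simp
  set e : ℝ := (adjPairs G I I : ℝ) with he
  set bad := {A ∈ I.powersetCard j |
    ¬ (adjPairs G A A : ℝ) * (#I : ℝ) ^ 2 ≤ 2 * (j : ℝ) ^ 2 * e} with hbad
  have hsplit : (#{A ∈ I.powersetCard j |
      (adjPairs G A A : ℝ) * (#I : ℝ) ^ 2 ≤ 2 * (j : ℝ) ^ 2 * e} : ℝ) + #bad =
      (#I).choose j := by
    rw [← card_powersetCard, ← Nat.cast_add, hbad, card_filter_add_card_filter_not]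
  have hX : 0 ≤ (j : ℝ) ^ 2 * e := by positivity
  have h1 : ∑ A ∈ I.powersetCard j, (adjPairs G A A : ℝ) * (#I : ℝ) ^ 2 ≤
      (j : ℝ) ^ 2 * e * (#I).choose j := by
    rw [← sum_mul]
    rcases Nat.eq_zero_or_pos (#I) with h0 | h0
    · rw [h0]
      simp only [Nat.cast_zero, ne_eq, OfNat.ofNat_ne_zero, not_false_eq_true, zero_pow, mul_zero]
      positivity
    · have hI : (0 : ℝ) < #I := by exact_mod_cast h0
      calc _ ≤ ((j : ℝ) / #I) ^ 2 * adjPairs G I I * (#I).choose j * (#I : ℝ) ^ 2 := by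
            gcongr
            exact sum_powersetCard_adjPairs_self_le hj
        _ = _ := by rw [he]; field_simp
  have h2 : (#bad : ℝ) * (2 * (j : ℝ) ^ 2 * e) ≤
      ∑ A ∈ I.powersetCard j, (adjPairs G A A : ℝ) * (#I : ℝ) ^ 2 := by
    rw [← nsmul_eq_mul, ← sum_const]
    refine (sum_le_sum fun A hA => ?_).trans
      (sum_le_sum_of_subset_of_nonneg (filter_subset _ _) fun _ _ _ => by positivity)
    exact (not_le.1 (mem_filter.1 hA).2).le
  rcases hX.eq_or_lt with h0 | h0
  -- Markov cannot divide by a zero average, but then every term of the sum vanishes.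
  · have h3 : bad = ∅ := by
      rw [hbad, filter_eq_empty_iff]
      intro A hA
      rw [not_not]
      rw [← h0, zero_mul] at h1
      have h4 := (single_le_sum (f := fun A => (adjPairs G A A : ℝ) * (#I : ℝ) ^ 2)
        (fun _ _ => by positivity) hA).trans h1
      linarith
    rw [h3, card_empty, Nat.cast_zero, add_zero] at hsplit
    rw [hsplit]
    linarith [Nat.cast_nonneg (α := ℝ) ((#I).choose j)]
  · have h3 : (#bad : ℝ) ≤ (#I).choose j / 2 := by
      have h4 := h2.trans h1
      refine le_of_mul_le_mul_right (a := (j : ℝ) ^ 2 * e) ?_ h0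
      linarith
    linarith

variable [Fintype V]

open Classical in
/-- A random sample contains, with probability at least `1 / 8`, a set of `k` vertices whose edge
density is at most twice that of `I`. -/
lemma choose_div_eight_le_card_filter (G : SimpleGraph V) {I : Finset V} {s k : ℕ}
    (hV : 0 < Fintype.card V) (hs : s ≤ Fintype.card V) (hk : k * Fintype.card V ≤ #I * s) :
    ((Fintype.card V).choose s : ℝ) / 8 ≤ #{S ∈ (univ : Finset V).powersetCard s |
      ∃ J ⊆ S, #J = k ∧ (adjPairs G J J : ℝ) * (#I : ℝ) ^ 2 ≤
        2 * (k : ℝ) ^ 2 * adjPairs G I I} := by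
  set tgt := {S ∈ (univ : Finset V).powersetCard s |
      ∃ J ⊆ S, #J = k ∧ (adjPairs G J J : ℝ) * (#I : ℝ) ^ 2 ≤
        2 * (k : ℝ) ^ 2 * adjPairs G I I} with htgt
  have hmaps : ∀ S ∈ tgt, #(S ∩ I) ∈ range (s + 1) := by
    intro S hS
    rw [htgt, mem_filter, mem_powersetCard_univ] at hS
    rw [mem_range, ← hS.1]
    exact Nat.lt_succ_of_le (card_le_card inter_subset_left)
  have h1 : ∑ j ∈ range (s + 1) with k ≤ j, (#{S ∈ tgt | #(S ∩ I) = j} : ℝ) ≤ #tgt := by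
    rw [card_eq_sum_card_fiberwise hmaps]
    push_cast
    exact sum_le_sum_of_subset_of_nonneg (filter_subset _ _) fun _ _ _ => by positivity
  have h2 : ∀ j ∈ {j ∈ range (s + 1) | k ≤ j},
      (#{S ∈ (univ : Finset V).powersetCard s | #(S ∩ I) = j} : ℝ) / 2 ≤
        #{S ∈ tgt | #(S ∩ I) = j} := by
    intro j hj
    rw [mem_filter, mem_range] at hj
    have hjs : j ≤ s := by omega
    have h3 := card_filter_inter_and (I := I) hjs fun A =>
      (adjPairs G A A : ℝ) * (#I : ℝ) ^ 2 ≤ 2 * (j : ℝ) ^ 2 * adjPairs G I I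
    have h4 := half_choose_le_card_filter G I j
    have h5 : {S ∈ (univ : Finset V).powersetCard s | #(S ∩ I) = j ∧
        (adjPairs G (S ∩ I) (S ∩ I) : ℝ) * (#I : ℝ) ^ 2 ≤ 2 * (j : ℝ) ^ 2 * adjPairs G I I} ⊆
        {S ∈ tgt | #(S ∩ I) = j} := by
      intro S hS
      rw [mem_filter] at hS
      rw [htgt, mem_filter, mem_filter]
      refine ⟨⟨hS.1, ?_⟩, hS.2.1⟩
      -- The trace may have more than `k` vertices; some `k`-subset of it has no larger density.
      obtain ⟨J, hJ, hJk, hJe⟩ := exists_subset_adjPairs_le (G := G) (B := S ∩ I) ∅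
        (w := k) (by rw [hS.2.1]; exact hj.2)
      refine ⟨J, hJ.trans inter_subset_left, hJk, ?_⟩
      have h6 : ∀ A : Finset V, adjPairs G A ∅ = 0 := fun A => by
        rw [adjPairs_comm]; simp [adjPairs]
      rw [h6, h6, hS.2.1] at hJe
      simp only [Nat.cast_zero, mul_zero, zero_add] at hJe
      rcases Nat.eq_zero_or_pos j with h0 | h0
      · rw [h0] at hJe
        simp only [Nat.cast_zero, div_zero, ne_eq, OfNat.ofNat_ne_zero, not_false_eq_true,
          zero_pow, zero_mul] at hJe
        have h7 : (adjPairs G J J : ℝ) = 0 := le_antisymm hJe (by positivity)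
        rw [h7, zero_mul]
        positivity
      · have hj0 : (0 : ℝ) < j := by exact_mod_cast h0
        calc (adjPairs G J J : ℝ) * (#I : ℝ) ^ 2
            ≤ ((k : ℝ) / j) ^ 2 * adjPairs G (S ∩ I) (S ∩ I) * (#I : ℝ) ^ 2 := by gcongr
          _ = ((k : ℝ) / j) ^ 2 * (adjPairs G (S ∩ I) (S ∩ I) * (#I : ℝ) ^ 2) := by ring
          _ ≤ ((k : ℝ) / j) ^ 2 * (2 * (j : ℝ) ^ 2 * adjPairs G I I) := by
            gcongr ?_ * ?_
            exact hS.2.2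
          _ = _ := by field_simp
    have h6 : (#{S ∈ (univ : Finset V).powersetCard s | #(S ∩ I) = j ∧
        (adjPairs G (S ∩ I) (S ∩ I) : ℝ) * (#I : ℝ) ^ 2 ≤ 2 * (j : ℝ) ^ 2 * adjPairs G I I} : ℝ) ≤
        #{S ∈ tgt | #(S ∩ I) = j} := by exact_mod_cast card_le_card h5
    refine le_trans ?_ h6
    rw [h3, card_filter_card_inter_eq hjs]
    push_cast
    have : (0 : ℝ) ≤ (Fintype.card V - #I).choose (s - j) := by positivity
    nlinarith
  have h3 := sum_le_sum h2
  rw [← sum_div] at h3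
  have h4 := quarter_le_card_filter_le_inter (I := I) hV hs hk
  linarith

end closeness

/-! ### Edge counts, edit distance and the tester -/

section edges

lemma two_mul_ncard_edgeSet {W : Type*} [Fintype W] (H : SimpleGraph W) :
    2 * H.edgeSet.ncard = adjPairs H univ univ := by
  classical
  rw [← SimpleGraph.coe_edgeFinset, Set.ncard_coe_finset, ← H.sum_degrees_eq_twice_card_edges]
  refine sum_congr rfl fun v _ => ?_
  rw [degInto, ← SimpleGraph.card_neighborFinset_eq_degree, SimpleGraph.neighborFinset_eq_filter]

lemma adjPairs_map {W V : Type*} {H : SimpleGraph W} {G : SimpleGraph V} (f : W ↪ V)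
    (hf : ∀ a b, H.Adj a b ↔ G.Adj (f a) (f b)) (A B : Finset W) :
    adjPairs H A B = adjPairs G (A.map f) (B.map f) := by
  classical
  rw [adjPairs_eq_sum, adjPairs_eq_sum]
  simp only [sum_map, hf]

lemma two_mul_ncard_edgeSet_induce {V : Type*} (G : SimpleGraph V) (B : Finset V) :
    2 * (G.induce (B : Set V)).edgeSet.ncard = adjPairs G B B := by
  rw [two_mul_ncard_edgeSet, adjPairs_map (G := G) (Function.Embedding.subtype (· ∈ (B : Set V)))
    (fun a b => Iff.rfl)]
  congr 1 <;> (ext v; simp)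

variable {n : ℕ}

/-- All edges of `G` inside `I` are absent from `H`, hence counted in the symmetric difference. -/
lemma ncard_le_editDist {G H : SimpleGraph (Fin n)} {I : Finset (Fin n)}
    (hI : H.IsIndepSet (I : Set (Fin n))) : adjPairs G I I ≤ 2 * editDist G H := by
  classical
  rw [← two_mul_ncard_edgeSet_induce]
  refine Nat.mul_le_mul_left 2 ?_
  rw [← Set.ncard_image_of_injective _
    (Sym2.map.injective (Subtype.val_injective (p := (· ∈ (I : Set (Fin n))))))]
  refine Set.ncard_le_ncard ?_ (Set.toFinite _)
  rintro _ ⟨e, he, rfl⟩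
  induction e using Sym2.ind with
  | _ a b =>
    rw [SimpleGraph.mem_edgeSet, SimpleGraph.comap_adj] at he
    refine Set.mem_symmDiff.2 (Or.inl ⟨by simpa using he, ?_⟩)
    have hab : (a : Fin n) ≠ b := he.ne
    simpa using hI a.2 b.2 hab

/-- Deleting the edges inside `B` yields a graph with independent set `B`. -/
lemma exists_isIndepSet_editDist (G : SimpleGraph (Fin n)) (B : Finset (Fin n)) :
    ∃ H : SimpleGraph (Fin n), H.IsIndepSet (B : Set (Fin n)) ∧
      2 * editDist G H = adjPairs G B B := by
  classical
  refine ⟨G \ (G.induce (B : Set (Fin n))).spanningCoe, ?_, ?_⟩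
  · intro a ha b hb _ hab
    rw [SimpleGraph.sdiff_adj] at hab
    exact hab.2 (by simpa [SimpleGraph.map_adj] using ⟨hab.1, ha, hb⟩)
  · have hle : (G.induce (B : Set (Fin n))).spanningCoe.edgeSet ⊆ G.edgeSet :=
      SimpleGraph.edgeSet_mono (SimpleGraph.spanningCoe_induce_le G _)
    have h1 : symmDiff G.edgeSet (G \ (G.induce (B : Set (Fin n))).spanningCoe).edgeSet =
        (G.induce (B : Set (Fin n))).spanningCoe.edgeSet := by
      rw [SimpleGraph.edgeSet_sdiff]
      ext e
      have := @hle e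
      rw [Set.mem_symmDiff, Set.mem_sdiff]
      tauto
    rw [editDist, h1, ← two_mul_ncard_edgeSet_induce, SimpleGraph.edgeSet_map,
      Set.ncard_image_of_injective _ (Function.Embedding.injective _)]

end edges

section testers

variable {n : ℕ}

lemma exists_sparse_finset_induce_iff (G : SimpleGraph (Fin n)) (S : Finset (Fin n)) (k : ℕ)
    (m : ℝ) :
    (∃ J : Finset (S : Set (Fin n)), #J = k ∧
      ((((G.induce (S : Set (Fin n))).induce
        (J : Set (S : Set (Fin n)))).edgeSet.ncard : ℝ) ≤ m)) ↔
    ∃ J ⊆ S, #J = k ∧ (adjPairs G J J : ℝ) ≤ 2 * m := by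
  have key : ∀ J : Finset (S : Set (Fin n)),
      2 * (((G.induce (S : Set (Fin n))).induce (J : Set (S : Set (Fin n)))).edgeSet.ncard : ℝ) =
        adjPairs G (J.map (Function.Embedding.subtype (· ∈ (S : Set (Fin n)))))
          (J.map (Function.Embedding.subtype (· ∈ (S : Set (Fin n))))) := by
    intro J
    rw [← adjPairs_map (H := G.induce (S : Set (Fin n))) _ (fun a b => Iff.rfl),
      ← two_mul_ncard_edgeSet_induce]
    push_cast
    rfl
  constructor
  · rintro ⟨J, hJ, hm⟩
    refine ⟨J.map (Function.Embedding.subtype (· ∈ (S : Set (Fin n)))), ?_, ?_, ?_⟩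
    · intro v hv
      obtain ⟨w, -, rfl⟩ := mem_map.1 hv
      exact w.2
    · rw [card_map, hJ]
    · rw [← key]
      linarith
  · rintro ⟨J, hJ, hk, hm⟩
    have hJ' : (J.subtype (· ∈ (S : Set (Fin n)))).map
        (Function.Embedding.subtype (· ∈ (S : Set (Fin n)))) = J := by
      rw [subtype_map, filter_eq_self]
      exact fun v hv => hJ hv
    refine ⟨J.subtype (· ∈ (S : Set (Fin n))), ?_, ?_⟩
    · rw [← hk, ← hJ', card_map, hJ']
    · have := key (J.subtype (· ∈ (S : Set (Fin n))))
      rw [hJ'] at this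
      linarith

open Classical in
lemma acceptProb_sparseSubsetRule (G : SimpleGraph (Fin n)) (s k : ℕ) (m : ℝ) :
    acceptProb s (sparseSubsetRule n k m) G =
      #{S ∈ (univ : Finset (Fin n)).powersetCard s |
        ∃ J ⊆ S, #J = k ∧ (adjPairs G J J : ℝ) ≤ 2 * m} / (n.choose s : ℝ) := by
  rw [acceptProb, card_filter]
  push_cast
  congr 1
  refine sum_congr rfl fun S _ => ?_
  rw [sparseSubsetRule]
  simp only [exists_sparse_finset_induce_iff]
  split_ifs <;> rfl

/-- The natural tester accepts close graphs with probability at least `1 / 8`. -/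
lemma le_acceptProb_of_isClose {s : ℕ} {ρ ε : ℝ} {G : SimpleGraph (Fin n)} (hn : 0 < n)
    (hs : s ≤ n) (hρ : 0 < ρ) (hG : IsClose (IndepSetProperty n ρ) ε G) :
    1 / 8 ≤ acceptProb s (sparseSubsetRule n ⌊ρ * (s : ℝ)⌋₊ (2 * ε * (s : ℝ) ^ 2)) G := by
  classical
  obtain ⟨H, ⟨I, hI, hIc⟩, hd⟩ := hG
  have hn' : (0 : ℝ) < n := by exact_mod_cast hn
  have hI0 : (0 : ℝ) < #I := lt_of_lt_of_le (by positivity) hIc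
  obtain ⟨K, hKI, hK⟩ := exists_subset_card_eq (s := I) (n := ⌈ρ * n⌉₊) (Nat.ceil_le.2 hIc)
  have hKc : ρ * n ≤ #K := by rw [hK]; exact Nat.le_ceil _
  have hK0 : (0 : ℝ) < #K := lt_of_lt_of_le (by positivity) hKc
  have he : (adjPairs G K K : ℝ) ≤ 2 * ε * n ^ 2 := by
    have h1 : (adjPairs G K K : ℝ) ≤ 2 * editDist G H := by
      exact_mod_cast (adjPairs_mono hKI hKI).trans (ncard_le_editDist hI)
    linarith
  have hk : ⌊ρ * (s : ℝ)⌋₊ * n ≤ #K * s := by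
    have h1 : (⌊ρ * (s : ℝ)⌋₊ : ℝ) ≤ ρ * s := Nat.floor_le (by positivity)
    have : (⌊ρ * (s : ℝ)⌋₊ : ℝ) * n ≤ #K * s := by
      calc (⌊ρ * (s : ℝ)⌋₊ : ℝ) * n ≤ ρ * s * n := by gcongr
        _ = ρ * n * s := by ring
        _ ≤ #K * s := by gcongr
    exact_mod_cast this
  have h8 := choose_div_eight_le_card_filter G (I := K) (s := s) (k := ⌊ρ * (s : ℝ)⌋₊)
    (by simpa using hn) (by simpa using hs) (by simpa using hk)
  rw [Fintype.card_fin] at h8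
  have hch : (0 : ℝ) < n.choose s := by exact_mod_cast Nat.choose_pos hs
  rw [acceptProb_sparseSubsetRule, le_div_iff₀ hch]
  refine le_trans (by linarith) (h8.trans (Nat.cast_le.2 (card_le_card ?_)))
  intro S hS
  rw [mem_filter] at hS ⊢
  refine ⟨hS.1, ?_⟩
  obtain ⟨J, hJ, hJk, hJe⟩ := hS.2
  refine ⟨J, hJ, hJk, ?_⟩
  have hkn : (⌊ρ * (s : ℝ)⌋₊ : ℝ) * n ≤ #K * s := by exact_mod_cast hk
  have h1 : (adjPairs G J J : ℝ) * (#K : ℝ) ^ 2 ≤ 2 * (2 * ε * s ^ 2) * #K ^ 2 := by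
    have h0 : 0 ≤ 2 * ε * n ^ 2 := le_trans (by positivity) he
    have hε : 0 ≤ ε := by
      by_contra hc
      push Not at hc
      nlinarith [pow_pos hn' 2]
    calc _ ≤ 2 * (⌊ρ * (s : ℝ)⌋₊ : ℝ) ^ 2 * adjPairs G K K := hJe
      _ ≤ 2 * (⌊ρ * (s : ℝ)⌋₊ : ℝ) ^ 2 * (2 * ε * n ^ 2) := by gcongr
      _ = 4 * ε * ((⌊ρ * (s : ℝ)⌋₊ : ℝ) * n) ^ 2 := by ring
      _ ≤ 4 * ε * ((#K : ℝ) * s) ^ 2 := by gcongr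
      _ = _ := by ring
  exact le_of_mul_le_mul_right h1 (by positivity)

lemma le_adjPairs_of_isFar {ρ ε : ℝ} {G : SimpleGraph (Fin n)}
    (hG : IsFar (IndepSetProperty n ρ) ε G) {B : Finset (Fin n)} (hB : ρ * n ≤ #B) :
    2 * ε * (n : ℝ) ^ 2 ≤ adjPairs G B B := by
  obtain ⟨H, hH, hd⟩ := exists_isIndepSet_editDist G B
  have h1 := hG H ⟨B, hH, hB⟩
  have h2 : (2 : ℝ) * editDist G H = adjPairs G B B := by exact_mod_cast hd
  linarith

/-- Far graphs exist only if `ε < 1 / 2` and `ε ≤ ρ ^ 2`. -/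
lemma lt_half_and_le_sq_of_isFar {ρ ε : ℝ} {G : SimpleGraph (Fin n)} (hn : 0 < n) (hρ : 0 < ρ)
    (hρ1 : ρ ≤ 1) (hε : 0 < ε) (hG : IsFar (IndepSetProperty n ρ) ε G) :
    ε < 1 / 2 ∧ ε ≤ ρ ^ 2 := by
  classical
  have hn' : (0 : ℝ) < n := by exact_mod_cast hn
  have hle : ⌈ρ * n⌉₊ ≤ #(univ : Finset (Fin n)) := by
    rw [card_univ, Fintype.card_fin, Nat.ceil_le]
    nlinarith
  obtain ⟨B, -, hB⟩ := exists_subset_card_eq hle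
  have hBc : ρ * n ≤ #B := by rw [hB]; exact Nat.le_ceil _
  have hB1 : (#B : ℝ) < ρ * n + 1 := by rw [hB]; exact Nat.ceil_lt_add_one (by positivity)
  have hBn : (#B : ℝ) ≤ n := by
    rw [card_univ, Fintype.card_fin] at hle
    rw [hB]; exact_mod_cast hle
  have h1 := le_adjPairs_of_isFar hG hBc
  have h2 : (adjPairs G B B : ℝ) ≤ #B * (#B - 1) := by
    have h3 : ∀ a ∈ B, (degInto G B a : ℝ) ≤ #B - 1 := by
      intro a ha
      have : degInto G B a + 1 ≤ #B := by
        rw [degInto, ← card_erase_add_one ha]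
        gcongr
        intro v hv
        rw [mem_filter] at hv
        exact mem_erase.2 ⟨hv.2.ne', hv.1⟩
      have : (degInto G B a : ℝ) + 1 ≤ #B := by exact_mod_cast this
      linarith
    rw [adjPairs, Nat.cast_sum]
    exact (sum_le_sum h3).trans (by rw [sum_const, nsmul_eq_mul])
  have hpos : 0 < ε * (n : ℝ) ^ 2 := by positivity
  have hB0 : (0 : ℝ) ≤ #B := by positivity
  -- A single vertex spans no edge, so farness forces `⌈ρ n⌉ ≥ 2`. Rounding up then costs at most a
  -- factor `2` in the number of pairs.
  have hB2 : (1 : ℝ) < #B := by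
    by_contra hc
    push Not at hc
    nlinarith
  have hB3 : (2 : ℝ) ≤ #B := by
    have : 1 < #B := by exact_mod_cast hB2
    exact_mod_cast this
  constructor
  · by_contra hc
    push Not at hc
    nlinarith [pow_pos hn' 2]
  · have h4 : (#B : ℝ) * (#B - 1) ≤ 2 * (ρ * n) * (ρ * n) := by
      have : (#B : ℝ) - 1 ≤ ρ * n := by linarith
      gcongr
      linarith
    have h5 : ε * (n : ℝ) ^ 2 ≤ ρ ^ 2 * n ^ 2 := by nlinarith
    exact le_of_mul_le_mul_right h5 (by positivity)

end testers

/-! ### Choice of parameters and soundness -/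

section parameters

variable {ε ρ : ℝ}

lemma one_lt_logb_inv (hε : 0 < ε) (hε2 : ε < 1 / 2) : 1 < Real.logb 2 (1 / ε) := by
  rw [Real.lt_logb_iff_rpow_lt (by norm_num) (by positivity), Real.rpow_one, lt_div_iff₀ hε]
  linarith

lemma logb_inv_le_inv (hε : 0 < ε) (hε2 : ε < 1 / 2) : Real.logb 2 (1 / ε) ≤ 1 / ε := by
  have h1 := one_add_mul_self_le_rpow_one_add (s := 1) (by norm_num) (one_lt_logb_inv hε hε2).le
  rw [one_add_one_eq_two, Real.rpow_logb (by norm_num) (by norm_num) (by positivity)] at h1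
  linarith

lemma log_le_of_le_two_pow_mul {x : ℝ} (hx : 0 < x) (hε : 0 < ε) (hε2 : ε < 1 / 2) {a b : ℕ}
    (h : x ≤ 2 ^ a * (1 / ε) ^ b) : Real.log x ≤ 7 / 10 * (a + b * Real.logb 2 (1 / ε)) := by
  have h2 : Real.log 2 ≤ 7 / 10 := by linarith [Real.log_two_lt_d9]
  have hl : Real.log (1 / ε) = Real.log 2 * Real.logb 2 (1 / ε) := by
    rw [Real.logb]; field_simp
  have hL := one_lt_logb_inv hε hε2
  calc Real.log x ≤ Real.log (2 ^ a * (1 / ε) ^ b) := Real.log_le_log hx h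
    _ = Real.log 2 * (a + b * Real.logb 2 (1 / ε)) := by
      rw [Real.log_mul (by positivity) (by positivity), Real.log_pow, Real.log_pow, hl]
      ring
    _ ≤ _ := by
      have : 0 ≤ a + b * Real.logb 2 (1 / ε) := by positivity
      gcongr

lemma natCast_le_of_two_pow_le {k a : ℕ} (hε : 0 < ε) (h : (2 : ℝ) ^ k ≤ 2 ^ a * (1 / ε)) :
    (k : ℝ) ≤ a + Real.logb 2 (1 / ε) := by
  have h1 := Real.logb_le_logb_of_le (b := 2) (by norm_num) (by positivity) h
  rw [Real.logb_mul (by positivity) (by positivity), Real.logb_pow, Real.logb_pow,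
    Real.logb_self_eq_one (by norm_num)] at h1
  linarith

/-- With `A = 100 log₂(1/ε)`, these are the constraints on `I`, `α` and `A` in `SparseSetting`: `2 ^
I` is of order `ρ² / ε`, and `2 ^ α` lies between `8 A` and `16 A`. -/
lemma exists_scales (hρ : 0 < ρ) (hρ1 : ρ ≤ 1) (hε : 0 < ε) (hε2 : ε < 1 / 2) (hερ : ε ≤ ρ ^ 2) :
    ∃ I α : ℕ, 8 * ρ ^ 2 ≤ ε * 2 ^ I ∧ ε * 2 ^ I ≤ 16 * ρ ^ 2 ∧
      800 * Real.logb 2 (1 / ε) ≤ 2 ^ α ∧ (2 : ℝ) ^ α ≤ 1600 * Real.logb 2 (1 / ε) ∧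
      (I + α + 1 : ℝ) ≤ 18 * Real.logb 2 (1 / ε) ∧
      20 * (Real.log (2 ^ I / ρ) + 1) ≤ 100 * Real.logb 2 (1 / ε) := by
  have hL := one_lt_logb_inv hε hε2
  have hL2 := logb_inv_le_inv hε hε2
  set L := Real.logb 2 (1 / ε) with hLdef
  obtain ⟨I, hI1, hI2⟩ := exists_nat_pow_near (x := 8 * ρ ^ 2 / ε) (y := 2)
    (by rw [le_div_iff₀ hε]; linarith) (by norm_num)
  obtain ⟨α, hα1, hα2⟩ := exists_nat_pow_near (x := 800 * L) (y := (2 : ℝ))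
    (by linarith) (by norm_num)
  rw [le_div_iff₀ hε] at hI1
  rw [div_lt_iff₀ hε] at hI2
  have hI3 : ε * 2 ^ (I + 1) ≤ 16 * ρ ^ 2 := by rw [pow_succ]; linarith
  have hα3 : (2 : ℝ) ^ (α + 1) ≤ 1600 * L := by rw [pow_succ]; linarith
  have hρ2 : ρ ^ 2 ≤ ρ := by nlinarith
  have hI4 : (2 : ℝ) ^ (I + 1) ≤ 2 ^ 4 * (1 / ε) := by
    rw [mul_one_div, le_div_iff₀ hε]; linarith
  have hI5 := natCast_le_of_two_pow_le hε hI4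
  have hα5 := natCast_le_of_two_pow_le (k := α + 1) (a := 11) hε (by linarith)
  rw [← hLdef] at hI5 hα5
  refine ⟨I + 1, α + 1, by linarith, hI3, hα2.le, hα3, ?_, ?_⟩
  · push_cast at hI5 hα5 ⊢
    linarith
  · have h1 : (2 : ℝ) ^ (I + 1) / ρ ≤ 2 ^ 4 * (1 / ε) ^ 1 := by
      rw [pow_one, mul_one_div, div_le_div_iff₀ hρ hε]; linarith
    have h2 := log_le_of_le_two_pow_mul (by positivity) hε hε2 h1
    rw [← hLdef] at h2
    push_cast at h2
    linarith

end parameters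

section soundness

variable {ε ρ : ℝ} {n : ℕ}

set_option maxHeartbeats 1000000 in
open Classical in
/-- The natural tester accepts far graphs with probability at most `1 / 16`. -/
lemma acceptProb_le_of_isFar {s : ℕ} {G : SimpleGraph (Fin n)} (hn : 0 < n)
    (hρ : 0 < ρ) (hρ1 : ρ ≤ 1) (hε : 0 < ε)
    (hs : s = ⌈(10 ^ 14 : ℝ) * (ρ ^ 3 * (Real.logb 2 (1 / ε)) ^ 5 / ε ^ 2)⌉₊) (hsn : s ≤ n)
    (hG : IsFar (IndepSetProperty n ρ) ε G) :
    acceptProb s (sparseSubsetRule n ⌊ρ * (s : ℝ)⌋₊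
      (2 * (ε / (10 ^ 10 * (Real.logb 2 (1 / ε)) ^ 4)) * (s : ℝ) ^ 2)) G ≤ 1 / 16 := by
  obtain ⟨hε2, hερ⟩ := lt_half_and_le_sq_of_isFar hn hρ hρ1 hε hG
  have hL := one_lt_logb_inv hε hε2
  have hL2 := logb_inv_le_inv hε hε2
  obtain ⟨I, α, hI1, hI2, hα1, hα2, hIα, hlog⟩ := exists_scales hρ hρ1 hε hε2 hερ
  have hlogb : ∀ x : ℝ, 0 < x → x ≤ 2 ^ 53 * (1 / ε) ^ 7 →
      Real.log x ≤ 7 / 10 * ((53 : ℕ) + (7 : ℕ) * Real.logb 2 (1 / ε)) :=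
    fun x hx h => log_le_of_le_two_pow_mul hx hε hε2 h
  set L := Real.logb 2 (1 / ε) with hLdef
  have hL0 : 0 < L := by linarith
  set X : ℝ := 10 ^ 14 * (ρ ^ 3 * L ^ 5 / ε ^ 2) with hX
  have hX0 : 0 < X := by positivity
  have hXs : X ≤ s := by rw [hs]; exact Nat.le_ceil _
  have hsX : (s : ℝ) < X + 1 := by rw [hs]; exact Nat.ceil_lt_add_one hX0.le
  have hs0 : (0 : ℝ) < s := by linarith
  have hsn' : (s : ℝ) ≤ n := by exact_mod_cast hsn
  -- `A` and `I + α + 1` are `O(L)`, so `μ_le` needs three powers of `L`. As `L > 1`, this `μ` is at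
  -- least `ε₁`.
  set μ : ℝ := ε / (10 ^ 10 * L ^ 3) with hμ
  have hμ0 : 0 < μ := by positivity
  set q : ℝ := 2 ^ I with hq
  have hq0 : 0 < q := by positivity
  have hb₁ : ε / (16 * ρ) ≤ ρ / q := by
    rw [div_le_div_iff₀ (by positivity) hq0]; nlinarith
  -- Of the `L ^ 5` in the sample size, `μ` consumes `L ^ 3`; the remaining `L ^ 2` dominates `log
  -- (32 s)` in the union bound.
  have hb₂ : 80000 * (ρ ^ 2 * L ^ 2 / ε) ≤ 8 * μ / ρ * s := by
    calc 80000 * (ρ ^ 2 * L ^ 2 / ε) = 8 * μ / ρ * X := by rw [hμ, hX]; field_simp; norm_num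
      _ ≤ _ := by gcongr
  have hερ1 : 1 ≤ ρ ^ 2 / ε := by rwa [one_le_div hε]
  have hb₁s : 100 ≤ ρ / q * s := by
    calc (100 : ℝ) ≤ 10 ^ 14 / 16 * 1 * 1 := by norm_num
      _ ≤ 10 ^ 14 / 16 * (ρ ^ 2 / ε) * L ^ 5 := by
        gcongr
        exact one_le_pow₀ hL.le
      _ = ε / (16 * ρ) * X := by rw [hX]; field_simp
      _ ≤ _ := by gcongr
  have hbad := card_filter_hasDenseContainer_le (s := s) (ρ := ρ) (b₁ := ρ / q) (b₂ := 8 * μ / ρ) G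
    (by simpa using hsn) (by exact_mod_cast hs0) hρ (by positivity) (by positivity) ?_ ?_ ?_
  · rw [Fintype.card_fin] at hbad
    have hch : (0 : ℝ) < n.choose s := by exact_mod_cast Nat.choose_pos hsn
    rw [acceptProb_sparseSubsetRule, div_le_iff₀ hch]
    refine le_trans (Nat.cast_le.2 (card_le_card ?_)) hbad
    intro S hS
    rw [mem_filter, mem_powersetCard_univ] at hS
    rw [mem_filter, mem_powersetCard_univ]
    refine ⟨hS.1, ?_⟩
    obtain ⟨J, hJS, hJk, hJe⟩ := hS.2
    -- A sparse `J` inside a sample without dense containers would form a `SparseSetting`; `η = 1 /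
    -- s` accounts for the floor in the size of `J`.
    by_contra hcon
    refine SparseSetting.false_of_sparseSetting (V := Fin n)
      { G := G, J := J, ρ := ρ, ε := ε, μ := μ, s := s, A := 100 * L, η := 1 / s, I := I, α := α
        ρ_pos := hρ, ρ_le_one := hρ1, ε_pos := hε, ε_le := hερ, μ_pos := hμ0, s_pos := hs0
        le_two_pow_I := hI1, log_le_A := hlog
        A_le_two_pow := by linarith
        two_pow_le_A := by linarith
        μ_le := ?_, cost_le := ?_, η_le := ?_, card_V := ?_
        far := ?_, sparse := ?_, le_card_J := ?_, card_J_le := ?_, noContainer := ?_ }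
    · calc 20000 * (100 * L) ^ 2 * ((I : ℝ) + α + 1) * μ
          ≤ 20000 * (100 * L) ^ 2 * (18 * L) * μ := by gcongr
        _ = 36 / 100 * ε := by rw [hμ]; field_simp; norm_num
        _ ≤ ε := by linarith
    · rw [pow_add, pow_add, pow_one, div_le_div_iff₀ hρ (by positivity), ← hq]
      calc 8 * μ * (q * 2 ^ α * 2) ≤ 8 * μ * (q * (1600 * L) * 2) := by gcongr
        _ = 25600 / 10 ^ 10 * (1 / L ^ 2) * (ε * q) := by rw [hμ]; field_simp; norm_num
        _ ≤ 25600 / 10 ^ 10 * 1 * (16 * ρ ^ 2) := by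
          gcongr
          rw [div_le_one (by positivity)]
          exact one_le_pow₀ hL.le
        _ ≤ ρ * ρ := by nlinarith [mul_pos hρ hρ]
    · rw [div_le_iff₀ hs0]
      linarith
    · rw [Fintype.card_fin]
      have : ρ / q * s ≤ ρ / q * n := by gcongr
      linarith
    · intro B hB
      rw [Fintype.card_fin] at hB ⊢
      exact le_adjPairs_of_isFar hG hB
    · refine hJe.trans ?_
      have : ε / (10 ^ 10 * L ^ 4) ≤ μ := by
        rw [hμ]
        gcongr
        · exact hL.le
        · norm_num
      nlinarith [pow_pos hs0 2]
    · have := (Nat.lt_floor_add_one (ρ * s)).le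
      rw [hJk, sub_mul, one_div_mul_cancel hs0.ne']
      linarith
    · rw [hJk]
      exact Nat.floor_le (by positivity)
    · intro w₁ w₂ hw₁ hw₂ h1 h2
      by_contra h3
      push Not at h3
      refine hcon ⟨w₁, w₂, ?_, ?_, h1, h2, ?_⟩
      · exact fun a ha => hJS (hw₁ a ha)
      · exact fun a ha => hJS (hw₂ a ha)
      · rw [hS.1]
        refine le_trans ?_ h3
        gcongr
  · refine le_trans ?_ hb₂
    have : ρ ^ 2 * L ^ 2 / ε = ρ ^ 2 / ε * L ^ 2 := by ring
    rw [this]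
    nlinarith [one_le_pow₀ hL.le (n := 2)]
  · have h1 : (1 : ℝ) ≤ L ^ 5 := one_le_pow₀ hL.le
    calc 64 * ρ ≤ 10 ^ 14 / 256 * ρ * 1 := by linarith
      _ ≤ 10 ^ 14 / 256 * ρ * L ^ 5 := by gcongr
      _ = (ε / (16 * ρ)) ^ 2 * X := by rw [hX]; field_simp; norm_num
      _ ≤ _ := by gcongr
  · have h1 : (32 : ℝ) * s ≤ 2 ^ 53 * (1 / ε) ^ 7 := by
      have h2 : 1 ≤ 1 / ε := by linarith
      have h3 : X ≤ 10 ^ 14 * (1 / ε) ^ 7 := by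
        calc X = 10 ^ 14 * (ρ ^ 3 * L ^ 5 * (1 / ε) ^ 2) := by rw [hX]; ring
          _ ≤ 10 ^ 14 * (1 * (1 / ε) ^ 5 * (1 / ε) ^ 2) := by
            gcongr
            exact pow_le_one₀ hρ.le hρ1
          _ = _ := by ring
      have h4 : 1 ≤ (1 / ε) ^ 7 := one_le_pow₀ h2
      linarith
    refine (hlogb _ (by positivity) h1).trans ?_
    calc 7 / 10 * ((53 : ℕ) + (7 : ℕ) * L) ≤ 300 * L ^ 2 := by push_cast; nlinarith
      _ ≤ ε / (16 * ρ) * (80000 * (ρ ^ 2 * L ^ 2 / ε)) / (16 * ρ) := by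
        have : ε / (16 * ρ) * (80000 * (ρ ^ 2 * L ^ 2 / ε)) / (16 * ρ) = 312.5 * L ^ 2 := by
          field_simp; norm_num
        rw [this]; nlinarith [pow_pos hL0 2]
      _ ≤ ρ / q * (8 * μ / ρ * s) / (16 * ρ) := by gcongr
      _ = _ := by ring

end soundness

/-! ### Sample complexity -/

section sampling

variable {n : ℕ}

lemma isTolerantTester_sparseSubsetRule {ε ρ : ℝ} {s : ℕ} (hn : 0 < n) (hρ : 0 < ρ) (hρ1 : ρ ≤ 1)
    (hε : 0 < ε)
    (hs : s = ⌈(10 ^ 14 : ℝ) * (ρ ^ 3 * (Real.logb 2 (1 / ε)) ^ 5 / ε ^ 2)⌉₊) (hsn : s ≤ n) :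
    IsTolerantTester (1 / 8) (1 / 16) (ε / (10 ^ 10 * (Real.logb 2 (1 / ε)) ^ 4)) ε
      (IndepSetProperty n ρ) s (sparseSubsetRule n ⌊ρ * (s : ℝ)⌋₊
        (2 * (ε / (10 ^ 10 * (Real.logb 2 (1 / ε)) ^ 4)) * (s : ℝ) ^ 2)) :=
  ⟨hsn, fun _ hG => le_acceptProb_of_isClose hn hsn hρ hG,
    fun _ hG => acceptProb_le_of_isFar hn hρ hρ1 hε hs hsn hG⟩

lemma exists_sampleComplexity_eq {δ₁ δ₂ ε₁ ε₂ : ℝ} {P : Set (SimpleGraph (Fin n))} {t : ℕ}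
    {A : DecisionRule n} (h : IsTolerantTester δ₁ δ₂ ε₁ ε₂ P t A) :
    ∃ s : ℕ, sampleComplexity δ₁ δ₂ ε₁ ε₂ P = s ∧ s ≤ t := by
  have h1 : sampleComplexity δ₁ δ₂ ε₁ ε₂ P ≤ t := iInf₂_le t ⟨A, h⟩
  obtain ⟨s, hs⟩ := ENat.ne_top_iff_exists.1 (h1.trans_lt (ENat.natCast_lt_top t)).ne
  refine ⟨s, hs.symm, ?_⟩
  rw [← hs] at h1
  exact_mod_cast h1

lemma isTolerantTester_one {δ₁ δ₂ ε₁ ε₂ : ℝ} {P : Set (SimpleGraph (Fin n))} (hδ : δ₁ ≤ 1)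
    (hP : ∀ G, ¬ IsFar P ε₂ G) : IsTolerantTester δ₁ δ₂ ε₁ ε₂ P 0 (fun _ _ => 1) := by
  refine ⟨Nat.zero_le _, fun G _ => ?_, fun G hG => (hP G hG).elim⟩
  simpa [acceptProb] using hδ

open Classical in
/-- A tester that sees the whole graph can decide membership exactly. -/
lemma exists_isTolerantTester_self {δ₁ δ₂ ε₁ ε₂ : ℝ} (P : Set (SimpleGraph (Fin n)))
    (hn : 0 < n) (hδ₁ : δ₁ ≤ 1) (hδ₂ : 0 ≤ δ₂) (hε : ε₁ < ε₂) :
    ∃ A, IsTolerantTester δ₁ δ₂ ε₁ ε₂ P n A := by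
  let A : DecisionRule n := fun S H =>
    if ∃ G, IsClose P ε₁ G ∧ G.induce (S : Set (Fin n)) = H then 1 else 0
  have hA : ∀ G, acceptProb n A G = if IsClose P ε₁ G then 1 else 0 := by
    intro G
    have h1 : (univ : Finset (Fin n)).powersetCard n = {univ} := by
      simpa using powersetCard_self (univ : Finset (Fin n))
    have h2 : (∃ G', IsClose P ε₁ G' ∧ G'.induce ((univ : Finset (Fin n)) : Set (Fin n)) =
        G.induce ((univ : Finset (Fin n)) : Set (Fin n))) ↔ IsClose P ε₁ G := by
      refine ⟨?_, fun h => ⟨G, h, rfl⟩⟩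
      rintro ⟨G', hG', h⟩
      have : G' = G := by
        ext a b
        have h3 := congrArg (fun K => K.Adj ⟨a, by simp⟩ ⟨b, by simp⟩) h
        simpa using h3
      exact this ▸ hG'
    rw [acceptProb, h1, sum_singleton, Nat.choose_self, Nat.cast_one, div_one]
    simp only [A, h2]
    split_ifs <;> rfl
  refine ⟨A, le_rfl, fun G hG => ?_, fun G hG => ?_⟩
  · rw [hA, if_pos hG]
    exact hδ₁
  · rw [hA, if_neg]
    · exact hδ₂
    · rintro ⟨H, hH, hd⟩
      have h1 := (hG H hH).trans hd
      have hn' : (0 : ℝ) < n := by exact_mod_cast hn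
      exact hε.not_ge (le_of_mul_le_mul_right h1 (by positivity))

/-- With `Y = ρ³ / ε²`, the hypothesis `ε ≤ ρ ^ 2` gives `1 / ε ≤ Y ^ 2`, so `log (1 / ε)` is at
most twice `log (2 + Y)`. As `Y ≥ 1`, the rounding is absorbed too. -/
lemma natCeil_sample_le {ε ρ : ℝ} (hρ : 0 < ρ) (hε : 0 < ε) (hε2 : ε < 1 / 2)
    (hερ : ε ≤ ρ ^ 2) :
    (⌈(10 ^ 14 : ℝ) * (ρ ^ 3 * (Real.logb 2 (1 / ε)) ^ 5 / ε ^ 2)⌉₊ : ℝ) ≤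
      64 * 10 ^ 14 * (ρ ^ 3 / ε ^ 2) * (Real.logb 2 (2 + ρ ^ 3 / ε ^ 2)) ^ 5 := by
  have hL := one_lt_logb_inv hε hε2
  set Y := ρ ^ 3 / ε ^ 2 with hY
  have hY0 : 0 < Y := by positivity
  have hY2 : 1 / ε ≤ Y ^ 2 := by
    have h1 : ε ^ 3 ≤ (ρ ^ 2) ^ 3 := by gcongr
    rw [hY, div_pow, div_le_div_iff₀ hε (by positivity)]
    calc 1 * (ε ^ 2) ^ 2 = ε ^ 3 * ε := by ring
      _ ≤ (ρ ^ 2) ^ 3 * ε := by gcongr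
      _ = _ := by ring
  have hY1 : 1 ≤ Y := by
    have : 2 < 1 / ε := by rw [lt_div_iff₀ hε]; linarith
    by_contra hc
    push Not at hc
    nlinarith
  set L := Real.logb 2 (1 / ε)
  have hLM : L ≤ 2 * Real.logb 2 (2 + Y) := by
    calc L ≤ Real.logb 2 (Y ^ 2) :=
          Real.logb_le_logb_of_le (by norm_num) (by positivity) hY2
      _ = 2 * Real.logb 2 Y := by rw [Real.logb_pow]; norm_num
      _ ≤ _ := by
        gcongr
        · norm_num
        · linarith
  have hL5 : 1 ≤ L ^ 5 := one_le_pow₀ hL.le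
  have hX1 : 1 ≤ Y * L ^ 5 := one_le_mul_of_one_le_of_one_le hY1 hL5
  have hX : (10 ^ 14 : ℝ) * (ρ ^ 3 * L ^ 5 / ε ^ 2) = 10 ^ 14 * (Y * L ^ 5) := by
    rw [hY]; ring
  rw [hX]
  calc (⌈(10 ^ 14 : ℝ) * (Y * L ^ 5)⌉₊ : ℝ) ≤ 10 ^ 14 * (Y * L ^ 5) + 1 :=
        (Nat.ceil_lt_add_one (by positivity)).le
    _ ≤ 2 * 10 ^ 14 * Y * L ^ 5 := by linarith
    _ ≤ 2 * 10 ^ 14 * Y * (2 * Real.logb 2 (2 + Y)) ^ 5 := by gcongr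
    _ = _ := by ring

/-- Without far graphs, accepting with no sample works. Otherwise the natural tester applies if its
sample fits into `n` vertices, and if not, reading the whole graph uses even fewer vertices. -/
lemma exists_sampleComplexity_eq_and_le {ε ρ : ℝ} (hn : 0 < n) (hρ : 0 < ρ) (hρ1 : ρ ≤ 1)
    (hε : 0 < ε) :
    ∃ s : ℕ, sampleComplexity (1 / 8) (1 / 16) (ε / (10 ^ 10 * (Real.logb 2 (1 / ε)) ^ 4)) ε
        (IndepSetProperty n ρ) = s ∧
      (s : ℝ) ≤ 64 * 10 ^ 14 * (ρ ^ 3 / ε ^ 2) * (Real.logb 2 (2 + ρ ^ 3 / ε ^ 2)) ^ 5 := by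
  by_cases h : ε < 1 / 2 ∧ ε ≤ ρ ^ 2
  · obtain ⟨hε2, hερ⟩ := h
    have hb := natCeil_sample_le hρ hε hε2 hερ
    suffices H : ∃ t A, t ≤ ⌈(10 ^ 14 : ℝ) * (ρ ^ 3 * (Real.logb 2 (1 / ε)) ^ 5 / ε ^ 2)⌉₊ ∧
        IsTolerantTester (1 / 8) (1 / 16) (ε / (10 ^ 10 * (Real.logb 2 (1 / ε)) ^ 4)) ε
          (IndepSetProperty n ρ) t A by
      obtain ⟨t, A, ht, hA⟩ := H
      obtain ⟨s, hs, hst⟩ := exists_sampleComplexity_eq hA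
      exact ⟨s, hs, (Nat.cast_le.2 (hst.trans ht)).trans hb⟩
    rcases le_or_gt ⌈(10 ^ 14 : ℝ) * (ρ ^ 3 * (Real.logb 2 (1 / ε)) ^ 5 / ε ^ 2)⌉₊ n with hs | hs
    · exact ⟨_, _, le_rfl, isTolerantTester_sparseSubsetRule hn hρ hρ1 hε rfl hs⟩
    · have hL := one_lt_logb_inv hε hε2
      have hlt : ε / (10 ^ 10 * (Real.logb 2 (1 / ε)) ^ 4) < ε := by
        refine div_lt_self hε ?_
        linarith [one_le_pow₀ hL.le (n := 4)]
      obtain ⟨A, hA⟩ := exists_isTolerantTester_self (δ₁ := 1 / 8) (δ₂ := 1 / 16)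
        (IndepSetProperty n ρ) hn (by norm_num) (by norm_num) hlt
      exact ⟨n, A, hs.le, hA⟩
  · obtain ⟨s, hs, hs0⟩ := exists_sampleComplexity_eq (isTolerantTester_one (δ₁ := 1 / 8)
      (δ₂ := 1 / 16) (ε₁ := ε / (10 ^ 10 * (Real.logb 2 (1 / ε)) ^ 4)) (by norm_num)
      fun G hG => h (lt_half_and_le_sq_of_isFar hn hρ hρ1 hε hG))
    refine ⟨s, hs, ?_⟩
    rw [Nat.le_zero.1 hs0, Nat.cast_zero]
    have : 0 ≤ Real.logb 2 (2 + ρ ^ 3 / ε ^ 2) := by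
      refine Real.logb_nonneg (by norm_num) ?_
      have : 0 < ρ ^ 3 / ε ^ 2 := by positivity
      linarith
    positivity

end sampling

end DenseTesting

theorem theorem1 :
    ∃ c C₁ C₂ δ₁ δ₂ : ℝ, 0 < c ∧ 0 < C₁ ∧ 0 < C₂ ∧ 0 < δ₂ ∧ δ₂ < δ₁ ∧ δ₁ < 1 ∧
      ∀ ε : ℝ, 0 < ε → ∀ ρ : ℝ, 0 < ρ → ρ ≤ 1 → ∀ n : ℕ, 0 < n →
        (∃ s : ℕ,
          DenseTesting.sampleComplexity δ₁ δ₂ (ε / (c * (Real.logb 2 (1 / ε)) ^ 4)) ε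
              (DenseTesting.IndepSetProperty n ρ) = (s : ℕ∞) ∧
          (s : ℝ) ≤ C₁ * (ρ ^ 3 / ε ^ 2) * (Real.logb 2 (2 + ρ ^ 3 / ε ^ 2)) ^ 5) ∧
        (∀ s : ℕ, s = ⌈C₂ * (ρ ^ 3 * (Real.logb 2 (1 / ε)) ^ 5 / ε ^ 2)⌉₊ → s ≤ n →
          DenseTesting.IsTolerantTester δ₁ δ₂ (ε / (c * (Real.logb 2 (1 / ε)) ^ 4)) ε
            (DenseTesting.IndepSetProperty n ρ) s
            (DenseTesting.sparseSubsetRule n ⌊ρ * (s : ℝ)⌋₊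
              (2 * (ε / (c * (Real.logb 2 (1 / ε)) ^ 4)) * (s : ℝ) ^ 2))) := by
  -- For `ε ≥ 1` the logarithm is nonpositive, so `⌈·⌉₊` gives `s = 0`; at `ε = 1`, division by zero
  -- makes `ε₁` equal to `0`. No graph is far in that range.
  refine ⟨10 ^ 10, 64 * 10 ^ 14, 10 ^ 14, 1 / 8, 1 / 16, by norm_num, by norm_num, by norm_num,
    by norm_num, by norm_num, by norm_num, fun ε hε ρ hρ hρ1 n hn => ⟨?_, fun s hs hsn => ?_⟩⟩
  · exact DenseTesting.exists_sampleComplexity_eq_and_le hn hρ hρ1 hε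
  · exact DenseTesting.isTolerantTester_sparseSubsetRule hn hρ hρ1 hε hs hsn
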